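/- Let $s\ge 2$ and $t$ be coprime natural numbers, let $n\ge 1$, and put $N=nt$ and $c=\frac12(s-1)(t-1)$. Let $\tilde{\mathfrak S}_s$ be the affine symmetric group, i.e. the group of permutations $w$ of $\mathbb Z$ with $w(m+s)=w(m)+s$ for all $m$ and $w(0)+\dots+w(s-1)=\binom s2$; it is generated by the elements $w_i$ ($i\in\mathbb Z/s\mathbb Z$), where $w_i$ adds $1$ to the integers congruent to $i-1$ modulo $s$, subtracts $1$ from those congruent to $i$, and fixes all others. The level $t$ action $w\mapsto\mathring w$ of $\tilde{\mathfrak S}_s$ on $\mathbb Z$ is the action in which $\mathring w_i$ adds $t$ to the integers congruent to $(i-1)t-c$ modulo $s$, subtracts $t$ from those congruent to $it-c$, and fixes all others. For a partition $\lambda$ write $\mathcal B^\lambda=\{\lambda_i-i\mid i\ge1\}$ for its beta-set. An $s$-core is a partition with no rim hook of size $s$; an $(s,t)$-core is a partition that is both an $s$-core and a $t$-core; the $t$-core of a partition is the $t$-core obtained by repeatedly removing rim hooks of size $t$. The $s$-set $\mathcal S(\lambda)$ of an $s$-core $\lambda$ consists, for each residue class modulo $s$, of the least integer in that class not in $\mathcal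 B^\lambda$. The level $t$ action $w\mapsto\check w$ on the set of all $s$-cores is given by $\mathcal B^{\check w\lambda}=\mathring w\,\mathcal B^\lambda$, and $\mathrm{Stab}_{s,t}(\lambda)$ is the stabiliser of $\lambda$ under this action. Let $\mathcal C_s^{(N)}$ be the set of all $s$-cores $\lambda$ with $k-l<Ns$ for all $k,l\in\mathcal S(\lambda)$. For $s$-cores $\lambda,\mu$ write $\lambda\equiv_N\mu$ if there is a bijection $f:\mathcal S(\lambda)\to\mathcal S(\mu)$ with $f(k)\equiv k\pmod{Ns}$ for all $k$. The level $t$ action $w\mapsto\hat w$ on $\mathcal C_s^{(N)}$ sends $\lambda$ to the unique $\hat w\lambda\in\mathcal C_s^{(N)}$ with $\check w\lambda\equiv_N\hat w\lambda$. Then $\check{\phantom w}$ and $\hat{\phantom w}$ are well-defined actions of $\tilde{\mathfrak S}_s$ on the set of all $s$-cores and on $\mathcal C_s^{(nt)}$ respectively, the set $\mathcal C_s^{(nt)}$ is finite, and it contains every $(s,t)$-core. For every $\lambda\in\mathcal C_s^{(nt)}$ the group $\mathrm{Stab}_{s,t}(\lambda)$ is finite, and the orbit of $\lambda$ under the level $t$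 action on $\mathcal C_s^{(nt)}$ has size $$\frac{n^{s-1}\,s!}{|\mathrm{Stab}_{s,t}(\lambda)|}.$$ This orbit contains exactly one $(s,t)$-core, and this $(s,t)$-core is the $t$-core of every member of the orbit. -/

import Mathlib

open scoped Nat

/-! ### The affine symmetric group -/

theorem periodic_add_mul {s : ℕ} (f : ℤ → ℤ) (hf : ∀ m, f (m + s) = f m) :
    ∀ k m : ℤ, f (m + s * k) = f m := by
  intro k
  induction k using Int.induction_on with
  | zero => simp
  | succ i ih => intro m; rw [← ih m, ← hf (m + s * i)]; congr 1; ring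
  | pred i ih => intro m; rw [← ih m, ← hf (m + s * (-i - 1))]; congr 1; ring

theorem equivariant_add_mul {s : ℕ} (w : ℤ → ℤ) (hw : ∀ m, w (m + s) = w m + s) :
    ∀ k m : ℤ, w (m + s * k) = w m + s * k := by
  intro k m
  have h := periodic_add_mul (fun m => w m - m) (fun m => by rw [hw]; ring) k m
  linarith

theorem sum_range_comp_of_periodic {s : ℕ} (w : Equiv.Perm ℤ)
    (hw : ∀ m, w (m + s) = w m + s) (f : ℤ → ℤ) (hf : ∀ m, f (m + s) = f m) :
    ∑ m ∈ Finset.range s, f (w m) = ∑ m ∈ Finset.range s, f m := by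
  rcases Nat.eq_zero_or_pos s with rfl | hs
  · simp
  have hs' : (s : ℤ) ≠ 0 := by exact_mod_cast hs.ne'
  have hfk := periodic_add_mul f hf
  have hwk := equivariant_add_mul w hw
  have key : ∀ m : ℤ, ((m % s).toNat : ℤ) = m % s :=
    fun m => Int.toNat_of_nonneg (Int.emod_nonneg m hs')
  have hmaps : Set.MapsTo (fun m : ℕ => ((w m) % s).toNat)
      (Finset.range s : Finset ℕ) (Finset.range s : Finset ℕ) := by
    intro m _
    have := Int.emod_lt_of_pos (w m) (by exact_mod_cast hs : (0 : ℤ) < s)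
    have h2 := key (w m)
    simp only [Finset.coe_range, Set.mem_Iio]
    omega
  have hinj : Set.InjOn (fun m : ℕ => ((w m) % s).toNat) (Finset.range s : Finset ℕ) := by
    intro a ha b hb hab
    simp only [Finset.coe_range, Set.mem_Iio] at ha hb
    have h1 : w a % s = w b % s := by
      rw [← key (w a), ← key (w b)]; exact_mod_cast hab
    have h2 : w a = w (b + s * (w a / s - w b / s)) := by
      rw [hwk]
      have e1 := Int.mul_ediv_add_emod (w a) s
      have e2 := Int.mul_ediv_add_emod (w b) s
      rw [h1] at e1
      linarith
    have h3 : (a : ℤ) % s = b % s := by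
      rw [w.injective h2]; simp
    rw [Int.emod_eq_of_lt (by omega) (by omega), Int.emod_eq_of_lt (by omega) (by omega)] at h3
    exact_mod_cast h3
  refine Finset.sum_nbij (fun m : ℕ => ((w m) % s).toNat) hmaps hinj ?_ ?_
  · exact Finset.surjOn_of_injOn_of_card_le _ hmaps hinj le_rfl
  · intro m _
    rw [key]
    conv_lhs => rw [← Int.emod_add_mul_ediv (w m) s]
    exact hfk _ _

theorem sum_range_cast (s : ℕ) : ∑ m ∈ Finset.range s, (m : ℤ) = s.choose 2 := by
  rw [Nat.choose_two_right, ← Finset.sum_range_id]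
  push_cast
  rfl

/-- The affine symmetric group of degree `s`: the permutations `w` of `ℤ` with
`w (m + s) = w m + s` for all `m` and `w 0 + w 1 + ⋯ + w (s - 1) = binom s 2`. -/
def AffineSym (s : ℕ) : Subgroup (Equiv.Perm ℤ) where
  carrier := {w | (∀ m, w (m + s) = w m + s) ∧ ∑ m ∈ Finset.range s, w m = s.choose 2}
  one_mem' := ⟨fun _ => rfl, sum_range_cast s⟩
  mul_mem' := by
    rintro v w ⟨hv, hv'⟩ ⟨hw, hw'⟩
    refine ⟨fun m => by simp [hv, hw], ?_⟩
    have h := sum_range_comp_of_periodic w hw (fun m => v m - m) (fun m => by simp [hv])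
    simp only [Finset.sum_sub_distrib, hv', hw', sum_range_cast] at h
    rw [Equiv.Perm.coe_mul]
    simp only [Function.comp_apply]
    linarith
  inv_mem' := by
    rintro w ⟨hw, hw'⟩
    have hi : ∀ m, w⁻¹ (m + s) = w⁻¹ m + s := by
      intro m
      apply w.injective
      simp [hw]
    refine ⟨hi, ?_⟩
    have h := sum_range_comp_of_periodic w hw (fun m => w⁻¹ m - m) (fun m => by simp [hi])
    simp only [Finset.sum_sub_distrib, hw', sum_range_cast] at h
    have e : ∀ x, w⁻¹ (w x) = x := w.symm_apply_apply
    simp only [e, sum_range_cast] at h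
    linarith

theorem sum_range_ite_dvd {s : ℕ} (hs : 0 < s) (i c : ℤ) :
    ∑ m ∈ Finset.range s, (if (s : ℤ) ∣ (m : ℤ) - i then c else 0) = c := by
  have hs' : (0 : ℤ) < s := by exact_mod_cast hs
  have h0 := Int.emod_nonneg i hs'.ne'
  have h1 := Int.emod_lt_of_pos i hs'
  have h2 : (((i % s).toNat : ℕ) : ℤ) = i % s := Int.toNat_of_nonneg h0
  rw [Finset.sum_eq_single (i % s).toNat]
  · rw [if_pos]
    rw [h2]
    exact (Int.modEq_iff_dvd).1 (Int.mod_modEq i s).symm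
  · intro b hb hbi
    rw [if_neg]
    intro hd
    apply hbi
    have h3 := (Int.modEq_iff_dvd.2 hd).symm
    rw [Int.ModEq, Int.emod_eq_of_lt (by omega) (by simpa using hb)] at h3
    omega
  · intro h
    exact absurd (Finset.mem_range.2 (by omega)) h

/-- The number `(s - 1) (t - 1) / 2`, an integer when `s` and `t` are coprime. -/
def halfProd (s t : ℕ) : ℤ := (((s - 1) * (t - 1) / 2 : ℕ) : ℤ)

/-- The generator with index `i` (mod `s`) of the level `t` action on `ℤ`: it adds `t` to the
integers in the class of `(i - 1) t - (s-1)(t-1)/2` modulo `s`, subtracts `t` from those in the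
class of `i t - (s-1)(t-1)/2`, and fixes all others. -/
def levelGenerator (s t : ℕ) (i m : ℤ) : ℤ :=
  if m ≡ (i - 1) * t - halfProd s t [ZMOD s] then m + t
  else if m ≡ i * t - halfProd s t [ZMOD s] then m - t
  else m

theorem levelGenerator_one (s : ℕ) (i m : ℤ) :
    levelGenerator s 1 i m =
      if (s : ℤ) ∣ m - (i - 1) then m + 1 else if (s : ℤ) ∣ m - i then m - 1 else m := by
  have h : ∀ j : ℤ, m ≡ j [ZMOD s] ↔ (s : ℤ) ∣ m - j := fun j =>
    ⟨fun h => Int.modEq_iff_dvd.1 h.symm, fun h => (Int.modEq_iff_dvd.2 h).symm⟩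
  simp [levelGenerator, halfProd, h]

theorem levelGenerator_one_involutive {s : ℕ} (hs : 2 ≤ s) (i : ℤ) :
    Function.Involutive (levelGenerator s 1 i) := by
  intro m
  have h1 : ¬ (s : ℤ) ∣ 1 := by
    intro h
    have := Int.le_of_dvd one_pos h
    omega
  simp only [levelGenerator_one]
  by_cases ha : (s : ℤ) ∣ m - (i - 1)
  · have h2 : ¬ (s : ℤ) ∣ m + 1 - (i - 1) := fun h =>
      h1 (by have := dvd_sub h ha; ring_nf at this; exact this)
    have h3 : (s : ℤ) ∣ m + 1 - i := by convert ha using 1; ring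
    simp [ha, h2, h3]
  · by_cases hb : (s : ℤ) ∣ m - i
    · have h3 : (s : ℤ) ∣ m - 1 - (i - 1) := by convert hb using 1; ring
      simp [ha, hb]
    · simp [ha, hb]

theorem levelGenerator_one_add (s : ℕ) (i m : ℤ) :
    levelGenerator s 1 i (m + s) = levelGenerator s 1 i m + s := by
  have h : ∀ j : ℤ, (s : ℤ) ∣ m + s - j ↔ (s : ℤ) ∣ m - j := fun j => by
    rw [show m + s - j = (m - j) + s by ring]; exact dvd_add_self_right
  simp only [levelGenerator_one, h]
  split_ifs <;> ring

/-- The standard generator `w_i` of the affine symmetric group: it adds `1` to the integers in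
the class of `i - 1` modulo `s`, subtracts `1` from those in the class of `i`, and fixes all
others. -/
def simpleReflection (s : ℕ) (hs : 2 ≤ s) (i : ℤ) : AffineSym s :=
  ⟨(levelGenerator_one_involutive hs i).toPerm _, levelGenerator_one_add s i, by
    have h : ∀ m : ℤ, levelGenerator s 1 i m = m +
        ((if (s : ℤ) ∣ m - (i - 1) then 1 else 0) - (if (s : ℤ) ∣ m - i then 1 else 0)) := by
      intro m
      have h1 : ¬ (s : ℤ) ∣ 1 := by
        intro h
        have := Int.le_of_dvd one_pos h
        omega
      rw [levelGenerator_one]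
      by_cases ha : (s : ℤ) ∣ m - (i - 1)
      · have h2 : ¬ (s : ℤ) ∣ m - i := fun h =>
          h1 (by have := dvd_sub ha h; ring_nf at this; exact this)
        simp [ha, h2]
      · by_cases hb : (s : ℤ) ∣ m - i
        · simp [ha, hb]; ring
        · simp [ha, hb]
    simp only [Function.Involutive.coe_toPerm, h, Finset.sum_add_distrib,
      Finset.sum_sub_distrib, sum_range_cast, sum_range_ite_dvd (show 0 < s by omega)]
    ring⟩

theorem simpleReflection_apply (s : ℕ) (hs : 2 ≤ s) (i m : ℤ) :
    (simpleReflection s hs i : Equiv.Perm ℤ) m = levelGenerator s 1 i m := rfl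

theorem eq_one_of_lt {s : ℕ} (hs : 2 ≤ s) (w : AffineSym s)
    (h : ∀ i : ℤ, (w : Equiv.Perm ℤ) i < (w : Equiv.Perm ℤ) (i + 1)) : w = 1 := by
  obtain ⟨w, hw, hw'⟩ := w
  simp only at h
  have hm : StrictMono w := strictMono_int_of_lt_succ h
  have hstep : ∀ i : ℤ, w (i + 1) = w i + 1 := by
    intro i
    obtain ⟨j, hj⟩ := w.surjective (w i + 1)
    have h1 : i < j := hm.lt_iff_lt.1 (by omega)
    have h2 : w (i + 1) ≤ w j := hm.monotone (by omega)
    have h3 := h i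
    omega
  have h1 := equivariant_add_mul (s := 1) w (by simpa using hstep)
  have h2 : ∀ k : ℤ, w k = w 0 + k := fun k => by simpa using h1 k 0
  have h3 : w 0 = 0 := by
    have e : ∀ m : ℕ, w (m : ℤ) = w 0 + m := fun m => h2 m
    simp only [e, Finset.sum_add_distrib, sum_range_cast, Finset.sum_const, Finset.card_range]
      at hw'
    have : (s : ℤ) * w 0 = 0 := by simpa using hw'
    rcases mul_eq_zero.1 this with h | h
    · omega
    · exact h
  apply Subtype.ext
  ext k
  simpa [h3] using h2 k

theorem closure_simpleReflection (s : ℕ) (hs : 2 ≤ s) :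
    Subgroup.closure (Set.range (simpleReflection s hs)) = ⊤ := by
  have main : ∀ (n : ℕ) (w : AffineSym s),
      ∑ m ∈ Finset.range s, ((w : Equiv.Perm ℤ) m - m) ^ 2 = (n : ℤ) →
      w ∈ Subgroup.closure (Set.range (simpleReflection s hs)) := by
    intro n
    induction n using Nat.strong_induction_on with
    | _ n ih =>
      intro w hn
      by_cases hlt : ∀ i : ℤ, (w : Equiv.Perm ℤ) i < (w : Equiv.Perm ℤ) (i + 1)
      · rw [eq_one_of_lt hs w hlt]
        exact one_mem _
      push Not at hlt
      obtain ⟨i, hi⟩ := hlt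
      have hne : (w : Equiv.Perm ℤ) (i + 1) ≠ (w : Equiv.Perm ℤ) i := fun h => by
        have := (w : Equiv.Perm ℤ).injective h
        omega
      have hw := w.2.1
      set r := simpleReflection s hs (i + 1) with hr
      have hrr : ∀ m, (r : Equiv.Perm ℤ) ((r : Equiv.Perm ℤ) m) = m :=
        levelGenerator_one_involutive hs (i + 1)
      have hrs := r.2.1
      have hd := equivariant_add_mul (w : Equiv.Perm ℤ) hw
      have hdiff : ∀ m : ℤ, ((w : Equiv.Perm ℤ) m - (r : Equiv.Perm ℤ) m) ^ 2 =
          ((w : Equiv.Perm ℤ) m - m) ^ 2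
          + ((if (s : ℤ) ∣ m - i then 1 - 2 * ((w : Equiv.Perm ℤ) i - i) else 0)
          + (if (s : ℤ) ∣ m - (i + 1)
              then 1 + 2 * ((w : Equiv.Perm ℤ) (i + 1) - (i + 1)) else 0)) := by
        intro m
        have h1 : ¬ (s : ℤ) ∣ 1 := by
          intro h
          have := Int.le_of_dvd one_pos h
          omega
        rw [hr, simpleReflection_apply, levelGenerator_one, show i + 1 - 1 = i by ring]
        by_cases ha : (s : ℤ) ∣ m - i
        · have h2 : ¬ (s : ℤ) ∣ m - (i + 1) := fun h =>
            h1 (by have := dvd_sub ha h; ring_nf at this; exact this)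
          obtain ⟨k, hk⟩ := ha
          have hm : m = i + s * k := by linarith
          have h4 := hd k i
          rw [← hm] at h4
          rw [if_pos ⟨k, hk⟩, if_pos ⟨k, hk⟩, if_neg h2, h4, hm]
          ring
        · by_cases hb : (s : ℤ) ∣ m - (i + 1)
          · obtain ⟨k, hk⟩ := hb
            have hm : m = (i + 1) + s * k := by linarith
            have h4 := hd k (i + 1)
            rw [← hm] at h4
            rw [if_neg ha, if_neg ha, if_pos ⟨k, hk⟩, if_pos ⟨k, hk⟩, h4, hm]
            ring
          · simp [ha, hb]
      have hsum : ∑ m ∈ Finset.range s, (((w * r : AffineSym s) : Equiv.Perm ℤ) m - m) ^ 2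
          = n + 2 * ((w : Equiv.Perm ℤ) (i + 1) - (w : Equiv.Perm ℤ) i) := by
        have h := sum_range_comp_of_periodic (r : Equiv.Perm ℤ) hrs
          (fun m => ((w : Equiv.Perm ℤ) m - (r : Equiv.Perm ℤ) m) ^ 2)
          (fun m => by simp only [hw, hrs]; ring)
        simp only [hrr] at h
        simp only [Subgroup.coe_mul, Equiv.Perm.mul_apply]
        rw [h]
        simp only [hdiff, Finset.sum_add_distrib, hn,
          sum_range_ite_dvd (show 0 < s by omega)]
        ring
      have hnn : (0 : ℤ) ≤
          ∑ m ∈ Finset.range s, (((w * r : AffineSym s) : Equiv.Perm ℤ) m - m) ^ 2 :=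
        Finset.sum_nonneg fun _ _ => sq_nonneg _
      have hmem := ih (∑ m ∈ Finset.range s,
        (((w * r : AffineSym s) : Equiv.Perm ℤ) m - m) ^ 2).toNat (by omega) (w * r)
        (Int.toNat_of_nonneg hnn).symm
      have hrm : r ∈ Subgroup.closure (Set.range (simpleReflection s hs)) :=
        Subgroup.subset_closure ⟨i + 1, rfl⟩
      simpa using mul_mem hmem (inv_mem hrm)
  refine eq_top_iff.2 fun w _ => ?_
  exact main _ w (Int.toNat_of_nonneg (Finset.sum_nonneg fun _ _ => sq_nonneg _)).symm

/-! ### The level `t` action on `ℤ` -/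

/-- An integer `i` with `i t ≡ m + (s-1)(t-1)/2` modulo `s`, when `s` and `t` are coprime
(see `levelIndex_mul`). -/
def levelIndex (s t : ℕ) (m : ℤ) : ℤ := Nat.gcdA t s * (m + halfProd s t)

theorem levelIndex_mul {s t : ℕ} (h : s.Coprime t) (m : ℤ) :
    levelIndex s t m * t ≡ m + halfProd s t [ZMOD s] := by
  have h1 := Nat.gcd_eq_gcd_ab t s
  rw [h.symm] at h1
  rw [Int.modEq_iff_dvd]
  refine ⟨Nat.gcdB t s * (m + halfProd s t), ?_⟩
  rw [levelIndex]
  push_cast at h1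
  linear_combination (m + halfProd s t) * h1

theorem modEq_of_mul_modEq {s t : ℕ} (h : s.Coprime t) {a b : ℤ}
    (hab : a * t ≡ b * t [ZMOD s]) : a ≡ b [ZMOD s] := by
  rw [Int.modEq_iff_dvd] at hab ⊢
  rw [← sub_mul] at hab
  exact (Nat.isCoprime_iff_coprime.2 h).dvd_of_dvd_mul_right hab

theorem displacement_congr {s : ℕ} (w : AffineSym s) {a b : ℤ} (h : a ≡ b [ZMOD s]) :
    (w : Equiv.Perm ℤ) a - a = (w : Equiv.Perm ℤ) b - b := by
  obtain ⟨k, hk⟩ := Int.modEq_iff_dvd.1 h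
  have h1 := equivariant_add_mul (w : Equiv.Perm ℤ) w.2.1 k a
  rw [show b = a + s * k by linarith, h1]
  ring

/-- The level `t` action of `w` on `ℤ`: `m ↦ m + t (w i - i)` where `i t ≡ m + (s-1)(t-1)/2`
modulo `s`. -/
def levelFun (s t : ℕ) (w : AffineSym s) (m : ℤ) : ℤ :=
  m + t * ((w : Equiv.Perm ℤ) (levelIndex s t m) - levelIndex s t m)

theorem levelFun_mul {s t : ℕ} (h : s.Coprime t) (v w : AffineSym s) (m : ℤ) :
    levelFun s t v (levelFun s t w m) = levelFun s t (v * w) m := by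
  have h1 : levelIndex s t (levelFun s t w m) ≡
      (w : Equiv.Perm ℤ) (levelIndex s t m) [ZMOD s] := by
    apply modEq_of_mul_modEq h
    refine (levelIndex_mul h _).trans ?_
    have h2 := (levelIndex_mul h m).symm
    rw [Int.modEq_iff_dvd] at h2 ⊢
    convert h2 using 1
    rw [levelFun]
    ring
  have h2 := displacement_congr v h1
  rw [levelFun, h2]
  simp only [levelFun, Subgroup.coe_mul, Equiv.Perm.mul_apply]
  ring

theorem levelFun_one (s t : ℕ) (m : ℤ) : levelFun s t 1 m = m := by simp [levelFun]

/-- The level `t` action of the affine symmetric group on `ℤ`. By `levelAction_simpleReflection`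
and `eq_levelAction` below, it is the unique action in which each standard generator `w_i` acts
as `levelGenerator s t i`. -/
def levelAction (s t : ℕ) (h : s.Coprime t) : AffineSym s →* Equiv.Perm ℤ where
  toFun w :=
    { toFun := levelFun s t w
      invFun := levelFun s t w⁻¹
      left_inv := fun m => by rw [levelFun_mul h, inv_mul_cancel, levelFun_one]
      right_inv := fun m => by rw [levelFun_mul h, mul_inv_cancel, levelFun_one] }
  map_one' := by ext m; exact levelFun_one s t m
  map_mul' v w := by ext m; exact (levelFun_mul h v w m).symm

theorem levelAction_simpleReflection (s t : ℕ) (hs : 2 ≤ s) (h : s.Coprime t) (i m : ℤ) :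
    levelAction s t h (simpleReflection s hs i) m = levelGenerator s t i m := by
  have key : ∀ j : ℤ, (s : ℤ) ∣ levelIndex s t m - j ↔
      m ≡ j * t - halfProd s t [ZMOD s] := by
    intro j
    have h1 : (s : ℤ) ∣ levelIndex s t m - j ↔ levelIndex s t m ≡ j [ZMOD s] :=
      ⟨fun h => (Int.modEq_iff_dvd.2 h).symm, fun h => Int.modEq_iff_dvd.1 h.symm⟩
    rw [h1]
    constructor
    · intro h2
      have h3 := (levelIndex_mul h m).symm.trans (h2.mul_right t)
      simpa using h3.sub_right (halfProd s t)
    · intro h2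
      apply modEq_of_mul_modEq h
      refine (levelIndex_mul h m).trans ?_
      simpa using h2.add_right (halfProd s t)
  change m + t * (levelGenerator s 1 i (levelIndex s t m) - levelIndex s t m) = _
  rw [levelGenerator_one, levelGenerator]
  simp only [key]
  split_ifs <;> ring

theorem eq_levelAction (s t : ℕ) (hs : 2 ≤ s) (h : s.Coprime t)
    (ρ : AffineSym s →* Equiv.Perm ℤ)
    (hρ : ∀ i m, ρ (simpleReflection s hs i) m = levelGenerator s t i m) :
    ρ = levelAction s t h := by
  refine MonoidHom.eq_of_eqOn_dense (closure_simpleReflection s hs) ?_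
  rintro _ ⟨i, rfl⟩
  ext m
  rw [hρ, levelAction_simpleReflection]

/-! ### Cores, beta-sets and `s`-sets -/

/-- The rim hook of `la` at the cell `x`: the cells `y` weakly below and weakly to the right of
`x` such that the cell diagonally below `y` is not in `la`. -/
def rimHook (la : YoungDiagram) (x : ℕ × ℕ) : Finset (ℕ × ℕ) :=
  la.cells.filter fun y => x.1 ≤ y.1 ∧ x.2 ≤ y.2 ∧ (y.1 + 1, y.2 + 1) ∉ la.cells

/-- `la` is an `s`-core: no hook length of `la`, i.e. no size of a rim hook, equals `s`. -/
def IsCore (s : ℕ) (la : YoungDiagram) : Prop :=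
  ∀ x ∈ la.cells, (rimHook la x).card ≠ s

/-- `mu` is obtained from `la` by removing one rim hook of size `t`. -/
def RemovesRimHook (t : ℕ) (la mu : YoungDiagram) : Prop :=
  ∃ x ∈ la.cells, (rimHook la x).card = t ∧ mu.cells = la.cells \ rimHook la x

/-- `mu` is a `t`-core obtained from `la` by repeatedly removing rim hooks of size `t`. -/
def IsCoreOf (t : ℕ) (mu la : YoungDiagram) : Prop :=
  IsCore t mu ∧ Relation.ReflTransGen (RemovesRimHook t) la mu

/-- The beta-set `{la_i - i | i ≥ 1}` (the rows of a Young diagram are numbered from `0`). -/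
def betaSet (la : YoungDiagram) : Set ℤ :=
  Set.range fun i : ℕ => (la.rowLen i : ℤ) - (i + 1)

/-- The `s`-set of `la`: for each class modulo `s`, the least integer of this class that is
not in the beta-set. -/
def sSet (s : ℕ) (la : YoungDiagram) : Set ℤ :=
  {a | IsLeast {b | b ≡ a [ZMOD s] ∧ b ∉ betaSet la} a}

/-- The set of all `s`-cores. -/
abbrev Cores (s : ℕ) : Type := {la : YoungDiagram // IsCore s la}

/-- The set of all `s`-cores whose `s`-set has spread less than `N s`. -/
abbrev BoundedCores (s N : ℕ) : Type :=
  {la : YoungDiagram // IsCore s la ∧ ∀ k ∈ sSet s la, ∀ l ∈ sSet s la, k - l < N * s}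

/-- The equivalence relation on `s`-cores: there is a bijection between the `s`-sets that
preserves residues modulo `N s`. -/
def CoreCongr (s N : ℕ) (la mu : YoungDiagram) : Prop :=
  ∃ f : sSet s la ≃ sSet s mu, ∀ k, (f k : ℤ) ≡ k [ZMOD ((N * s : ℕ) : ℤ)]

/-! ### The level `t` actions on cores -/

/-- A ternary relation `R g x y` is the graph `g • x = y` of an action of the group `G`. -/
def IsActionGraph {G X : Type*} [Group G] (R : G → X → X → Prop) : Prop :=
  ∃ ρ : G →* Equiv.Perm X, ∀ g x y, R g x y ↔ ρ g x = y

/-- `w` sends the `s`-core `la` to the `s`-core `mu` in the level `t` action on `s`-cores. -/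
def ActsOnCores (s t : ℕ) (h : s.Coprime t) (w : AffineSym s) (la mu : Cores s) : Prop :=
  betaSet mu.1 = levelAction s t h w '' betaSet la.1

/-- `w` sends `la` to `mu` in the level `t` action on the `s`-cores whose `s`-set has spread less
than `N s`: the image of `la` in the level `t` action on all `s`-cores is equivalent to `mu`. -/
def ActsOnBoundedCores (s t N : ℕ) (h : s.Coprime t) (w : AffineSym s)
    (la mu : BoundedCores s N) : Prop :=
  ∃ ka : Cores s, ActsOnCores s t h w ⟨la.1, la.2.1⟩ ka ∧ CoreCongr s N ka.1 mu.1

/-- The stabiliser of the `s`-core `la` in the level `t` action on all `s`-cores. -/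
def coreStabilizer (s t : ℕ) (h : s.Coprime t) (la : Cores s) : Set (AffineSym s) :=
  {w | ActsOnCores s t h w la la}

/-- The orbit of `la` in the level `t` action on the `s`-cores whose `s`-set has spread less
than `N s`. -/
def boundedOrbit (s t N : ℕ) (h : s.Coprime t) (la : BoundedCores s N) :
    Set (BoundedCores s N) :=
  {mu | ∃ w, ActsOnBoundedCores s t N h w la mu}

/-! Write `c` for `halfProd s t`. As `s` and `t` are coprime, every integer has the form `i t - c +
s v`, where `(i, v)` is unique up to `(i + s, v - t)`. In these coordinates the level `t` action of
`w` is `(i, v) ↦ (w i, v)` (`levelAction_levelPos`); subtracting `s` lowers `v` by one and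
subtracting `t` lowers `i` by one. So the beta-set of an `s`-core is given by the condition `v < y
i` for a sequence `y` with `y (i + s) = y i - t`. The choice of `c` makes the charge of this set `y
0 + ⋯ + y (s - 1)`, which is zero for a beta-set. Thus `s`-cores correspond to `levelSeq s t`, `w`
acts by `y ↦ y ∘ w⁻¹`, the `t`-cores are the antitone sequences, and `CoreCongr` is congruence of
sequences modulo `N`.

Each congruence class contains exactly one sequence of small spread (`exists_smallSpread`,
`SmallSpread.eq`). For `N = n t`, congruent sequences differ by composition with a translation in `K
= congrSubgroup s n` (`exists_translation_of_modEq`). Hence the orbit consists of the bounded cores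
in the orbit under the action on all `s`-cores (`mem_boundedOrbit_iff`), and the stabiliser for the
bounded action is `K H`, where `H` is the stabiliser of `y`. The index of `K` is `n ^ (s - 1) * s
!`, and `K` meets `H` trivially because a nontrivial translation changes `y`. So `H` is finite and
the orbit has size `n ^ (s - 1) * s ! / |H|`.

Sorting `y` puts a `t`-core in the orbit (`exists_antitone`). Its uniqueness comes from the runners,
the sets of `i` belonging to a fixed `v`: removing a `t`-rim hook moves one `i` to `i - 1`, and `w`
permutes the `i`, so both preserve the charge of every runner. The runners of a `t`-core are
half-lines, determined by their charges. All members of the orbit therefore have the same `t`-core,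
and an `(s, t)`-core is its own `t`-core. -/

/-! ### Beta-sets and rim hooks -/

/-- The entry of the beta-set that belongs to row `i`. -/
def bead (la : YoungDiagram) (i : ℕ) : ℤ := (la.rowLen i : ℤ) - (i + 1)

/-- The integer outside the beta-set that belongs to column `j`. -/
def gap (la : YoungDiagram) (j : ℕ) : ℤ := (j : ℤ) - la.colLen j

theorem mem_betaSet {la : YoungDiagram} {x : ℤ} : x ∈ betaSet la ↔ ∃ i, bead la i = x := Iff.rfl

theorem bead_strictAnti (la : YoungDiagram) : StrictAnti (bead la) := by
  refine strictAnti_nat_of_succ_lt fun i => ?_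
  have := la.rowLen_anti i (i + 1) (Nat.le_succ i)
  simp only [bead]
  push_cast
  omega

theorem lt_rowLen_iff_lt_colLen (la : YoungDiagram) (i j : ℕ) :
    j < la.rowLen i ↔ i < la.colLen j := by
  rw [← YoungDiagram.mem_iff_lt_rowLen, YoungDiagram.mem_iff_lt_colLen]

theorem gap_lt_bead_iff (la : YoungDiagram) (i j : ℕ) :
    gap la j < bead la i ↔ j < la.rowLen i := by
  have h := lt_rowLen_iff_lt_colLen la i j
  simp only [gap, bead]
  omega

theorem bead_ne_gap (la : YoungDiagram) (i j : ℕ) : bead la i ≠ gap la j := by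
  have h := lt_rowLen_iff_lt_colLen la i j
  simp only [gap, bead]
  omega

theorem gap_notMem_betaSet (la : YoungDiagram) (j : ℕ) : gap la j ∉ betaSet la := by
  rintro ⟨i, hi⟩
  exact bead_ne_gap la i j hi

theorem exists_rowLen_eq_zero (la : YoungDiagram) : ∃ M, ∀ i, M ≤ i → la.rowLen i = 0 := by
  refine ⟨la.colLen 0, fun i hi => ?_⟩
  have := lt_rowLen_iff_lt_colLen la i 0
  omega

/-- If exactly `h` beads exceed `x`, then column `x + h` has exactly `h` cells, so its gap is `x`.
Beads and gaps thus partition `ℤ`. -/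
theorem exists_gap_eq {la : YoungDiagram} {x : ℤ} (hx : x ∉ betaSet la) :
    ∃ j, gap la j = x := by
  classical
  have hne : ∀ i, bead la i ≠ x := fun i hi => hx ⟨i, hi⟩
  have hex : ∃ i, bead la i < x := by
    obtain ⟨M, hM⟩ := exists_rowLen_eq_zero la
    refine ⟨M + x.natAbs, ?_⟩
    rw [bead, hM _ (by omega)]
    omega
  obtain ⟨h, h1, h2⟩ : ∃ h, bead la h < x ∧ ∀ r < h, x < bead la r := by
    refine ⟨Nat.find hex, Nat.find_spec hex, fun r hr => ?_⟩
    have := Nat.find_min hex hr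
    have := hne r
    omega
  have hj : 0 ≤ x + h := by
    simp only [bead] at h1
    omega
  have hc : la.colLen (x + h).toNat = h := by
    apply le_antisymm
    · have := lt_rowLen_iff_lt_colLen la h (x + h).toNat
      simp only [bead] at h1
      omega
    · rcases Nat.eq_zero_or_pos h with rfl | hh
      · exact Nat.zero_le _
      · have := lt_rowLen_iff_lt_colLen la (h - 1) (x + h).toNat
        have h3 := h2 (h - 1) (by omega)
        simp only [bead] at h3
        omega
  exact ⟨(x + h).toNat, by rw [gap, hc]; omega⟩

theorem betaSet_injective : Function.Injective betaSet := by
  intro la mu h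
  have h1 : bead la = bead mu := by
    have e : StrictMono (fun i => OrderDual.toDual (bead la i)) := bead_strictAnti la
    have e' : StrictMono (fun i => OrderDual.toDual (bead mu i)) := bead_strictAnti mu
    exact (e.range_inj e').1 h
  have h2 : ∀ i, la.rowLen i = mu.rowLen i := by
    intro i
    have := congrFun h1 i
    simp only [bead] at this
    omega
  apply YoungDiagram.ext
  ext ⟨i, j⟩
  rw [YoungDiagram.mem_cells, YoungDiagram.mem_cells, YoungDiagram.mem_iff_lt_rowLen,
    YoungDiagram.mem_iff_lt_rowLen, h2]

theorem mem_rimHook {la : YoungDiagram} {i j r k : ℕ} :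
    (r, k) ∈ rimHook la (i, j) ↔
      k < la.rowLen r ∧ i ≤ r ∧ j ≤ k ∧ la.rowLen (r + 1) ≤ k + 1 := by
  simp [rimHook, YoungDiagram.mem_cells, YoungDiagram.mem_iff_lt_rowLen]

/-- In row `r` the hook is an interval of columns whose length is the increment of `r - max (rowLen
r) (j + 1)`; summing over rows `i` to `colLen j - 1` telescopes. -/
theorem card_rimHook {la : YoungDiagram} {i j : ℕ} (h : j < la.rowLen i) :
    ((rimHook la (i, j)).card : ℤ) = bead la i - gap la j := by
  obtain ⟨H, hH⟩ : ∃ H, H = la.colLen j := ⟨_, rfl⟩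
  have hiH : i < H := hH ▸ (lt_rowLen_iff_lt_colLen la i j).1 h
  have hu : rimHook la (i, j) = (Finset.Ico i H).biUnion fun r =>
      (Finset.Ico (max j (la.rowLen (r + 1) - 1)) (la.rowLen r)).image fun k => (r, k) := by
    ext ⟨r, k⟩
    rw [mem_rimHook]
    have := lt_rowLen_iff_lt_colLen la r j
    simp only [Finset.mem_biUnion, Finset.mem_Ico, Finset.mem_image, Prod.mk.injEq]
    constructor
    · rintro ⟨h1, h2, h3, h4⟩
      exact ⟨r, by omega, k, by omega, rfl, rfl⟩
    · rintro ⟨r, h1, k, h2, rfl, rfl⟩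
      omega
  rw [hu, Finset.card_biUnion]
  · have e : ∀ r ∈ Finset.Ico i H,
        ((((Finset.Ico (max j (la.rowLen (r + 1) - 1)) (la.rowLen r)).image
          fun k => (r, k)).card : ℕ) : ℤ) =
        ((r + 1 : ℕ) - max (la.rowLen (r + 1) : ℤ) (j + 1)) - (r - max (la.rowLen r : ℤ) (j + 1))
          := by
      intro r hr
      have h0 := la.rowLen_anti r (r + 1) (Nat.le_succ r)
      have := lt_rowLen_iff_lt_colLen la r j
      rw [Finset.mem_Ico] at hr
      rw [Finset.card_image_of_injective _ (fun a b hab => (Prod.mk.inj hab).2), Nat.card_Ico]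
      rcases lt_or_ge (j + 1) (la.rowLen (r + 1)) with h1 | h1
      · rw [max_eq_right (by omega), max_eq_left (by omega), max_eq_left (by omega)]
        omega
      · rw [max_eq_left (by omega), max_eq_right (by omega), max_eq_left (by omega)]
        omega
    push_cast at e ⊢
    rw [Finset.sum_congr rfl e]
    have e2 := Finset.sum_Ico_sub (fun r : ℕ => (r : ℤ) - max (la.rowLen r : ℤ) (j + 1)) hiH.le
    push_cast at e2
    have := lt_rowLen_iff_lt_colLen la H j
    rw [e2, max_eq_right (by omega), max_eq_left (by omega)]
    simp only [bead, gap]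
    omega
  · intro a _ b _ hab
    rw [Function.onFun, Finset.disjoint_left]
    rintro ⟨r, k⟩ h1 h2
    simp only [Finset.mem_image, Prod.mk.injEq] at h1 h2
    obtain ⟨_, _, rfl, _⟩ := h1
    obtain ⟨_, _, rfl, _⟩ := h2
    exact hab rfl

/-- Hook lengths are the positive differences bead minus gap, so a hook of length `t` is a bead `b`
for which `b - t` is a gap. -/
theorem isCore_iff {t : ℕ} (ht : 0 < t) (la : YoungDiagram) :
    IsCore t la ↔ ∀ b ∈ betaSet la, b - t ∈ betaSet la := by
  constructor
  · rintro h _ ⟨i, rfl⟩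
    by_contra hb
    obtain ⟨j, hj⟩ := exists_gap_eq hb
    change gap la j = bead la i - t at hj
    have hij : j < la.rowLen i := (gap_lt_bead_iff la i j).1 (by omega)
    refine h (i, j) ?_ ?_
    · rwa [YoungDiagram.mem_cells, YoungDiagram.mem_iff_lt_rowLen]
    · have := card_rimHook hij
      omega
  · rintro h ⟨i, j⟩ hx hc
    rw [YoungDiagram.mem_cells, YoungDiagram.mem_iff_lt_rowLen] at hx
    have h1 := card_rimHook hx
    have h2 := h (bead la i) ⟨i, rfl⟩
    rw [hc] at h1
    rw [h1, sub_sub_cancel] at h2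
    exact gap_notMem_betaSet la j h2

theorem exists_removesRimHook {t : ℕ} {la : YoungDiagram} (h : ¬ IsCore t la) :
    ∃ mu, RemovesRimHook t la mu := by
  simp only [IsCore, not_forall, not_not] at h
  obtain ⟨x, hx, hc⟩ := h
  refine ⟨⟨la.cells \ rimHook la x, ?_⟩, x, hx, hc, rfl⟩
  rintro y z hzy hy
  simp only [Finset.coe_sdiff, Set.mem_sdiff, Finset.mem_coe, rimHook, Finset.mem_filter,
    not_and, not_not] at hy ⊢
  have hz : z ∈ la.cells := la.isLowerSet hzy hy.1
  refine ⟨hz, fun _ h1 h2 => ?_⟩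
  exact la.isLowerSet (show (z.1 + 1, z.2 + 1) ≤ (y.1 + 1, y.2 + 1) from
    ⟨Nat.succ_le_succ hzy.1, Nat.succ_le_succ hzy.2⟩)
    (hy.2 hy.1 (h1.trans hzy.1) (h2.trans hzy.2))

theorem exists_isCoreOf {t : ℕ} (ht : 0 < t) (la : YoungDiagram) : ∃ mu, IsCoreOf t mu la := by
  induction hc : la.cells.card using Nat.strong_induction_on generalizing la with
  | _ m ih =>
    by_cases h : IsCore t la
    · exact ⟨la, h, Relation.ReflTransGen.refl⟩
    · obtain ⟨nu, hnu⟩ := exists_removesRimHook h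
      have hlt : nu.cells.card < m := by
        obtain ⟨x, -, hx, hnu⟩ := hnu
        have hsub : rimHook la x ⊆ la.cells := Finset.filter_subset _ _
        have := Finset.card_sdiff_add_card_eq_card hsub
        rw [hnu]
        omega
      obtain ⟨mu, h1, h2⟩ := ih _ hlt nu rfl
      exact ⟨mu, h1, Relation.ReflTransGen.head hnu h2⟩

/-- Within the hook, the new row `r` is the old row `r + 1` shortened by one cell, so it inherits
bead `r + 1`; the last row of the hook is cut back to length `j` and receives the gap of column `j`.
The net effect is that the bead of row `i` moves to that gap. -/
theorem betaSet_of_removesRimHook {t : ℕ} {la mu : YoungDiagram} (h : RemovesRimHook t la mu) :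
    ∃ b ∈ betaSet la, b - t ∉ betaSet la ∧ betaSet mu = insert (b - t) (betaSet la \ {b}) := by
  obtain ⟨⟨i, j⟩, hx, hc, hmu⟩ := h
  rw [YoungDiagram.mem_cells, YoungDiagram.mem_iff_lt_rowLen] at hx
  have hcard := card_rimHook hx
  rw [hc] at hcard
  have hg : bead la i - t = gap la j := by omega
  have hrow : ∀ r k, k < mu.rowLen r ↔
      k < la.rowLen r ∧ ¬ (i ≤ r ∧ j ≤ k ∧ la.rowLen (r + 1) ≤ k + 1) := by
    intro r k
    rw [← YoungDiagram.mem_iff_lt_rowLen, ← YoungDiagram.mem_cells, hmu, Finset.mem_sdiff,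
      mem_rimHook, YoungDiagram.mem_cells, YoungDiagram.mem_iff_lt_rowLen]
    tauto
  have hlen : ∀ r, mu.rowLen r = if i ≤ r then min (la.rowLen r) (max j (la.rowLen (r + 1) - 1))
      else la.rowLen r := by
    intro r
    apply eq_of_forall_lt_iff
    intro k
    rw [hrow]
    split_ifs
    · simp only [lt_min_iff, lt_max_iff]
      omega
    · omega
  have hbead : ∀ r, bead mu r = if r < i ∨ la.colLen j ≤ r then bead la r
      else if r + 1 < la.colLen j then bead la (r + 1) else gap la j := by
    intro r
    have h1 := lt_rowLen_iff_lt_colLen la r j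
    have h2 := lt_rowLen_iff_lt_colLen la (r + 1) j
    have h3 := la.rowLen_anti r (r + 1) (Nat.le_succ r)
    have h4 := hlen r
    simp only [bead, gap]
    split_ifs at h4 ⊢ <;> push_cast <;> omega
  have hiH := (lt_rowLen_iff_lt_colLen la i j).1 hx
  refine ⟨bead la i, ⟨i, rfl⟩, hg ▸ gap_notMem_betaSet la j, ?_⟩
  rw [hg]
  ext x
  simp only [Set.mem_insert_iff, Set.mem_sdiff, Set.mem_singleton_iff, mem_betaSet]
  constructor
  · rintro ⟨r, rfl⟩
    rw [hbead]
    split_ifs with h1 h2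
    · exact Or.inr ⟨⟨r, rfl⟩, fun h => by have := (bead_strictAnti la).injective h; omega⟩
    · exact Or.inr ⟨⟨r + 1, rfl⟩, fun h => by have := (bead_strictAnti la).injective h; omega⟩
    · exact Or.inl rfl
  · rintro (rfl | ⟨⟨r, rfl⟩, h⟩)
    · refine ⟨la.colLen j - 1, ?_⟩
      rw [hbead, if_neg (by omega), if_neg (by omega)]
    · have hri : r ≠ i := fun e => h (by rw [e])
      rcases Nat.lt_or_ge r (la.colLen j) with h1 | h1
      · rcases Nat.lt_or_ge r i with h2 | h2
        · exact ⟨r, by rw [hbead, if_pos (Or.inl h2)]⟩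
        · refine ⟨r - 1, ?_⟩
          rw [hbead, if_neg (by omega), if_pos (by omega), Nat.sub_add_cancel (by omega)]
      · exact ⟨r, by rw [hbead, if_pos (Or.inr h1)]⟩

/-! ### The charge of a set of integers -/

/-- The set `A` of integers has charge `c`: it arises from the set of negative integers by adding
finitely many elements and removing finitely many, `c` more being added than removed. -/
def HasCharge (A : Set ℤ) (c : ℤ) : Prop :=
  HasSum (fun x => A.indicator (fun _ => (1 : ℤ)) x - (Set.Iio 0).indicator (fun _ => (1 : ℤ)) x) c

theorem hasSum_of_forall_eq {f g : ℤ → ℤ} {a : ℤ} (h : ∀ x, f x = g x) (hf : HasSum f a) :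
    HasSum g a := by
  rwa [← funext h]

theorem HasCharge.eq {A : Set ℤ} {c d : ℤ} (h : HasCharge A c) (h' : HasCharge A d) : c = d :=
  h.unique h'

theorem hasCharge_insert_iff {A : Set ℤ} {b c : ℤ} (hb : b ∉ A) :
    HasCharge (insert b A) (c + 1) ↔ HasCharge A c := by
  have e : (insert b A).indicator (fun _ => (1 : ℤ)) =
      A.indicator (fun _ => (1 : ℤ)) + Pi.single b 1 := by
    ext x
    by_cases hx : x = b
    · subst hx
      simp [hb]
    · by_cases hA : x ∈ A <;> simp [Set.indicator, hx, hA]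
  have hs : HasSum (Pi.single b (1 : ℤ)) 1 := hasSum_pi_single b 1
  unfold HasCharge
  rw [e]
  constructor
  · intro h
    have h2 := h.sub hs
    rw [add_sub_cancel_right] at h2
    refine hasSum_of_forall_eq (fun x => ?_) h2
    simp only [Pi.add_apply]
    ring
  · intro h
    convert h.add hs using 1
    ext x
    simp only [Pi.add_apply]
    ring

theorem hasCharge_move_iff {A : Set ℤ} {a b c : ℤ} (ha : a ∈ A) (hb : b ∉ A) :
    HasCharge (insert b (A \ {a})) c ↔ HasCharge A c := by
  have h1 : b ∉ A \ {a} := fun h => hb h.1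
  have h2 : a ∉ A \ {a} := fun h => h.2 rfl
  have h3 : insert a (A \ {a}) = A := by
    rw [Set.insert_sdiff_singleton, Set.insert_eq_of_mem ha]
  have e : c = (c - 1) + 1 := by ring
  rw [e, hasCharge_insert_iff h1]
  conv_rhs => rw [← h3]
  rw [hasCharge_insert_iff h2]

theorem hasCharge_Iio (p : ℤ) : HasCharge (Set.Iio p) p := by
  have key : ∀ p : ℤ, Set.Iio (p + 1) = insert p (Set.Iio p) := by
    intro p
    ext x
    simp only [Set.mem_Iio, Set.mem_insert_iff]
    omega
  induction p using Int.induction_on with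
  | zero => simp [HasCharge]
  | succ i ih => rwa [key, hasCharge_insert_iff (by simp)]
  | pred i ih =>
    have e : (-(i : ℤ)) = -i - 1 + 1 := by ring
    rw [e, key, hasCharge_insert_iff (by simp)] at ih
    exact ih

theorem hasCharge_finset_union (T : Finset ℤ) (m : ℤ) (hT : ∀ x ∈ T, m ≤ x) :
    HasCharge (↑T ∪ Set.Iio m) (T.card + m) := by
  induction T using Finset.induction_on with
  | empty => simpa using hasCharge_Iio m
  | insert a T ha ih =>
    have h := hT a (Finset.mem_insert_self _ _)
    rw [Finset.card_insert_of_notMem ha, Finset.coe_insert, Set.insert_union]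
    push_cast
    rw [add_right_comm, hasCharge_insert_iff]
    · exact ih fun x hx => hT x (Finset.mem_insert_of_mem hx)
    · rintro (h1 | h1)
      · exact ha h1
      · exact absurd h (not_le.2 h1)

/-- The summand for `w '' A` is the summand for `A` reindexed by `w`, plus the summand for `w ''
Set.Iio 0`. -/
theorem hasCharge_image {w : Equiv.Perm ℤ}
    (hw : HasCharge (w '' Set.Iio 0) 0) {A : Set ℤ} {c : ℤ} (h : HasCharge A c) :
    HasCharge (w '' A) c := by
  have e : ∀ (B : Set ℤ) (x : ℤ), (w '' B).indicator (fun _ => (1 : ℤ)) x =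
      B.indicator (fun _ => (1 : ℤ)) (w.symm x) := by
    intro B x
    have : x ∈ w '' B ↔ w.symm x ∈ B := by rw [Equiv.image_eq_preimage_symm]; rfl
    by_cases hx : w.symm x ∈ B
    · rw [Set.indicator_of_mem hx, Set.indicator_of_mem (this.2 hx)]
    · rw [Set.indicator_of_notMem hx, Set.indicator_of_notMem (fun h => hx (this.1 h))]
  have h1 := (w.symm.hasSum_iff).2 h
  unfold HasCharge at hw ⊢
  convert h1.add hw using 1
  · ext x
    simp only [Function.comp_apply, e]
    ring
  · ring

/-- A generator `w_i` exchanges `-1` and `0` if `s ∣ i` and otherwise preserves the negative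
integers; in both cases the image of the negative integers has charge zero. -/
theorem hasCharge_image_affineSym {s : ℕ} (hs : 2 ≤ s) (w : AffineSym s) {A : Set ℤ} {c : ℤ}
    (h : HasCharge A c) : HasCharge ((w : Equiv.Perm ℤ) '' A) c := by
  have hw : w ∈ Subgroup.closure (Set.range (simpleReflection s hs)) := by
    rw [closure_simpleReflection]
    trivial
  have hgen : ∀ i, HasCharge ((simpleReflection s hs i : Equiv.Perm ℤ) '' Set.Iio 0) 0 := by
    intro i
    have hinv := levelGenerator_one_involutive hs i
    have hmem : ∀ x, x ∈ (simpleReflection s hs i : Equiv.Perm ℤ) '' Set.Iio 0 ↔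
        levelGenerator s 1 i x < 0 := by
      intro x
      constructor
      · rintro ⟨y, hy, rfl⟩
        rw [simpleReflection_apply, hinv y]
        exact hy
      · intro hx
        exact ⟨_, hx, hinv x⟩
    by_cases hi : (s : ℤ) ∣ i
    · have : (simpleReflection s hs i : Equiv.Perm ℤ) '' Set.Iio 0 =
          insert 0 (Set.Iio 0 \ {-1}) := by
        ext x
        rw [hmem, levelGenerator_one]
        have h1 : ¬ (s : ℤ) ∣ 1 := by
          intro h
          have := Int.le_of_dvd one_pos h
          omega
        simp only [Set.mem_insert_iff, Set.mem_sdiff, Set.mem_Iio, Set.mem_singleton_iff]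
        by_cases hx0 : x = 0
        · subst hx0
          have : ¬ (s : ℤ) ∣ 0 - (i - 1) := fun h => h1 (by
            have := dvd_add h hi
            ring_nf at this
            exact this)
          rw [if_neg this, if_pos (by simpa using hi)]
          simp
        · by_cases hx1 : x = -1
          · subst hx1
            rw [if_pos (by simpa [sub_eq_add_neg] using hi)]
            simp
          · split_ifs <;> omega
      rw [this, hasCharge_move_iff (by simp) (by simp)]
      exact hasCharge_Iio 0
    · have : (simpleReflection s hs i : Equiv.Perm ℤ) '' Set.Iio 0 = Set.Iio 0 := by
        ext x
        rw [hmem, levelGenerator_one, Set.mem_Iio]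
        have h1 : (s : ℤ) ∣ x - (i - 1) → x ≠ -1 := by
          rintro h rfl
          apply hi
          simpa [sub_eq_add_neg] using h
        have h2 : (s : ℤ) ∣ x - i → x ≠ 0 := by
          rintro h rfl
          apply hi
          simpa using h
        split_ifs with h3 h4
        · have := h1 h3
          omega
        · have := h2 h4
          omega
        · rfl
      rw [this]
      exact hasCharge_Iio 0
  -- The equivalence, for all `A` and `c`, is what passes to inverses in the closure induction.
  suffices ∀ (A : Set ℤ) (c : ℤ), HasCharge A c ↔ HasCharge ((w : Equiv.Perm ℤ) '' A) c from
    (this A c).1 h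
  clear h A c
  induction hw using Subgroup.closure_induction with
  | mem w hw =>
    obtain ⟨i, rfl⟩ := hw
    intro A c
    refine ⟨hasCharge_image (hgen i), fun h => ?_⟩
    have e := hasCharge_image (hgen i) h
    have hinv : ∀ x, (simpleReflection s hs i : Equiv.Perm ℤ)
      ((simpleReflection s hs i : Equiv.Perm ℤ) x) = x := levelGenerator_one_involutive hs i
    simpa only [Set.image_image, hinv, Set.image_id'] using e
  | one => simp
  | mul v w _ _ hv hw =>
    intro A c
    rw [hw, hv, ← Set.image_comp, ← Equiv.Perm.coe_mul, Subgroup.coe_mul]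
  | inv w _ hw =>
    intro A c
    rw [hw (((w⁻¹ : AffineSym s) : Equiv.Perm ℤ) '' A), ← Set.image_comp,
      ← Equiv.Perm.coe_mul, Subgroup.coe_inv, mul_inv_cancel]
    simp

/-- Each class modulo `s` is a copy of `ℤ`, on which the negative integers restrict to `u < 0`; so
the class of `r` contributes the charge of `Set.Iio (q r)`. -/
theorem hasCharge_of_classes {s : ℕ} (hs : 0 < s) {A : Set ℤ} {q : ℕ → ℤ}
    (h : ∀ r < s, ∀ u : ℤ, (r : ℤ) + s * u ∈ A ↔ u < q r) :
    HasCharge A (∑ r ∈ Finset.range s, q r) := by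
  classical
  have hs' : (s : ℤ) ≠ 0 := by exact_mod_cast hs.ne'
  unfold HasCharge
  set F : ℤ → ℤ := fun x => A.indicator (fun _ => (1 : ℤ)) x -
    (Set.Iio 0).indicator (fun _ => (1 : ℤ)) x with hF
  have hsplit : F = fun x : ℤ => ∑ r ∈ Finset.range s, if x % s = r then F x else 0 := by
    ext x
    have h0 := Int.emod_nonneg x hs'
    have h1 := Int.emod_lt_of_pos x (by exact_mod_cast hs : (0 : ℤ) < s)
    rw [Finset.sum_eq_single (x % s).toNat]
    · rw [if_pos (by omega)]
    · intro b _ hb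
      rw [if_neg (by omega)]
    · intro h
      exact absurd (Finset.mem_range.2 (by omega)) h
  rw [hsplit]
  refine hasSum_sum fun r hr => ?_
  have hrs := Finset.mem_range.1 hr
  have hinj : Function.Injective fun u : ℤ => (r : ℤ) + s * u := by
    intro a b hab
    have : (s : ℤ) * a = s * b := by simpa using hab
    exact mul_left_cancel₀ hs' this
  rw [← hinj.hasSum_iff]
  · refine hasSum_of_forall_eq (fun u => ?_) (hasCharge_Iio (q r))
    have hmod : ((r : ℤ) + s * u) % s = r := by
      rw [Int.add_mul_emod_self_left, Int.emod_eq_of_lt (by omega) (by omega)]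
    simp only [Function.comp_apply, hmod, if_true, hF, Set.indicator_apply, h r hrs u, Set.mem_Iio]
    have : (r : ℤ) + s * u < 0 ↔ u < 0 := by
      constructor
      · intro h
        by_contra hu
        have : 0 ≤ (s : ℤ) * u := mul_nonneg (by omega) (by omega)
        omega
      · intro hu
        have : (s : ℤ) * u ≤ s * (-1) := mul_le_mul_of_nonneg_left (by omega) (by omega)
        omega
    simp only [this]
  · intro x hx
    rw [if_neg]
    intro hxr
    exact hx ⟨x / s, by simp only [← hxr]; exact Int.emod_add_mul_ediv x s⟩

/-! ### Beta-sets are the sets of charge zero -/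

theorem range_eq_of_eventually {b : ℕ → ℤ} {M : ℕ} (hM : ∀ i, M ≤ i → b i = -(i + 1)) :
    Set.range b = ↑((Finset.range M).image b) ∪ Set.Iio (-(M : ℤ)) := by
  ext x
  simp only [Set.mem_range, Set.mem_union, Finset.coe_image, Set.mem_image, Finset.coe_range,
    Set.mem_Iio]
  constructor
  · rintro ⟨i, rfl⟩
    rcases lt_or_ge i M with h | h
    · exact Or.inl ⟨i, h, rfl⟩
    · right
      rw [hM i h]
      omega
  · rintro (⟨i, -, rfl⟩ | h)
    · exact ⟨i, rfl⟩
    · exact ⟨(-x - 1).toNat, by rw [hM _ (by omega)]; omega⟩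

theorem hasCharge_range {b : ℕ → ℤ} (hb : StrictAnti b) {M : ℕ}
    (hM : ∀ i, M ≤ i → b i = -(i + 1)) : HasCharge (Set.range b) 0 := by
  have h := hasCharge_finset_union ((Finset.range M).image b) (-M) (by
    intro x hx
    obtain ⟨i, hi, rfl⟩ := Finset.mem_image.1 hx
    have h1 := hb (Finset.mem_range.1 hi)
    rw [hM M le_rfl] at h1
    omega)
  rw [Finset.card_image_of_injective _ hb.injective, Finset.card_range, add_neg_cancel] at h
  rwa [range_eq_of_eventually hM]

theorem exists_bead_eventually (la : YoungDiagram) :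
    ∃ M : ℕ, ∀ i, M ≤ i → bead la i = -(i + 1) := by
  obtain ⟨M, hM⟩ := exists_rowLen_eq_zero la
  exact ⟨M, fun i hi => by rw [bead, hM i hi]; simp⟩

theorem hasCharge_betaSet (la : YoungDiagram) : HasCharge (betaSet la) 0 := by
  obtain ⟨M, hM⟩ := exists_bead_eventually la
  exact hasCharge_range (bead_strictAnti la) hM

theorem exists_bound_betaSet (la : YoungDiagram) :
    ∃ M : ℕ, (∀ x ∈ betaSet la, x < M) ∧ ∀ x : ℤ, x < -M → x ∈ betaSet la := by
  obtain ⟨M, hM⟩ := exists_bead_eventually la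
  refine ⟨M + la.rowLen 0, ?_, fun x hx => ⟨(-x - 1).toNat, ?_⟩⟩
  · rintro _ ⟨i, rfl⟩
    have := la.rowLen_anti 0 i (Nat.zero_le _)
    push_cast
    omega
  · refine (hM _ (by omega)).trans (by omega)

theorem exists_bead_eq {b : ℕ → ℤ} (hb : StrictAnti b) {M : ℕ}
    (hM : ∀ i, M ≤ i → b i = -(i + 1)) : ∃ la, bead la = b := by
  have hstep : ∀ i, b (i + 1) + (i + 1 : ℕ) ≤ b i + i := by
    intro i
    have := hb (Nat.lt_succ_self i)
    push_cast
    simp only [Nat.succ_eq_add_one] at this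
    omega
  have hanti : Antitone fun i : ℕ => b i + i := antitone_nat_of_succ_le hstep
  have hnn : ∀ i, 0 ≤ b i + i + 1 := by
    intro i
    have h1 := hanti (Nat.le_max_left i M)
    simp only [hM _ (Nat.le_max_right i M)] at h1
    omega
  let la : YoungDiagram :=
    { cells := (Finset.range M ×ˢ Finset.range (b 0 + 1).toNat).filter fun x => x.2 < b x.1 + x.1 + 1
      isLowerSet := by
        rintro ⟨i, j⟩ ⟨i', j'⟩ ⟨h1, h2⟩ h
        simp only [Finset.coe_filter, Finset.mem_product, Finset.mem_range, Set.mem_ofPred_eq] at h ⊢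
        have := hanti h1
        simp only at h1 h2 this
        omega }
  have hrow : ∀ i, (la.rowLen i : ℤ) = b i + i + 1 := by
    intro i
    have hk : ∀ k : ℕ, k < la.rowLen i ↔ (k : ℤ) < b i + i + 1 := by
      intro k
      rw [← YoungDiagram.mem_iff_lt_rowLen, ← YoungDiagram.mem_cells]
      simp only [la, Finset.mem_filter, Finset.mem_product, Finset.mem_range]
      have h0 := hanti (Nat.zero_le i)
      simp only at h0
      by_cases hi : i < M
      · omega
      · have := hM i (by omega)
        omega
    have h1 := hk (la.rowLen i)
    have h2 := hk (b i + i + 1).toNat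
    have := hnn i
    omega
  refine ⟨la, ?_⟩
  ext i
  rw [bead, hrow]
  ring

/-- Charge zero forces exactly `M` elements `≥ -M`. Listed in decreasing order and followed by `-M -
1, -M - 2, …`, they are the beads of a partition. -/
theorem exists_betaSet_eq {A : Set ℤ} (hA : HasCharge A 0) {M : ℕ} (h1 : ∀ x ∈ A, x < M)
    (h2 : ∀ x : ℤ, x < -M → x ∈ A) : ∃ la, betaSet la = A := by
  classical
  set T : Finset ℤ := (Finset.Ico (-(M : ℤ)) M).filter (· ∈ A) with hT
  have hAT : (T : Set ℤ) ∪ Set.Iio (-(M : ℤ)) = A := by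
    ext x
    simp only [hT, Set.mem_union, Finset.coe_filter, Finset.mem_Ico, Set.mem_ofPred_eq, Set.mem_Iio]
    constructor
    · rintro (h | h)
      · exact h.2
      · exact h2 x h
    · intro h
      have := h1 x h
      rcases lt_or_ge x (-(M : ℤ)) with h3 | h3
      · exact Or.inr h3
      · exact Or.inl ⟨⟨h3, this⟩, h⟩
  have hTm : ∀ x ∈ T, -(M : ℤ) ≤ x := fun x hx =>
    (Finset.mem_Ico.1 (Finset.mem_filter.1 hx).1).1
  have hcard : T.card = M := by
    have h := hasCharge_finset_union T (-M) hTm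
    rw [hAT] at h
    have := h.eq hA
    omega
  let e := T.orderEmbOfFin hcard
  let b : ℕ → ℤ := fun i => if h : i < M then e (Fin.rev ⟨i, h⟩) else -(i + 1)
  have hM : ∀ i, M ≤ i → b i = -(i + 1) := fun i hi => dif_neg (by omega)
  have hb : StrictAnti b := by
    intro i j hij
    simp only [b]
    split_ifs with h3 h4 h4
    · exact e.strictMono (Fin.rev_lt_rev.2 hij)
    · omega
    · have := hTm _ (T.orderEmbOfFin_mem hcard (Fin.rev ⟨i, h4⟩))
      simp only [e]
      omega
    · omega
  obtain ⟨la, hla⟩ := exists_bead_eq hb hM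
  refine ⟨la, ?_⟩
  change Set.range (bead la) = A
  rw [hla, range_eq_of_eventually hM, ← hAT]
  congr 1
  have : T = (Finset.range M).image b := by
    symm
    apply Finset.eq_of_subset_of_card_le
    · intro x hx
      obtain ⟨i, hi, rfl⟩ := Finset.mem_image.1 hx
      simp only [b, dif_pos (Finset.mem_range.1 hi)]
      exact T.orderEmbOfFin_mem hcard _
    · rw [Finset.card_image_of_injective _ hb.injective, Finset.card_range, hcard]
  rw [this]

/-! ### Level sequences -/

/-- The integer with coordinates `i`, `v`; the pairs `(i, v)` and `(i + s, v - t)` give the same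
integer. -/
def levelPos (s t : ℕ) (i v : ℤ) : ℤ := i * t - halfProd s t + s * v

theorem pos_of_coprime {s t : ℕ} (hs : 2 ≤ s) (h : s.Coprime t) : 0 < t := by
  rcases Nat.eq_zero_or_pos t with rfl | ht
  · rw [Nat.coprime_zero_right] at h
    omega
  · exact ht

theorem two_mul_halfProd {s t : ℕ} (hs : 2 ≤ s) (h : s.Coprime t) :
    2 * halfProd s t = ((s : ℤ) - 1) * (t - 1) := by
  have ht := pos_of_coprime hs h
  have hev : 2 ∣ (s - 1) * (t - 1) := by
    by_contra hodd
    rw [Nat.two_dvd_ne_zero, ← Nat.odd_iff, Nat.odd_mul, Nat.odd_iff, Nat.odd_iff] at hodd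
    have : 2 ∣ s.gcd t := Nat.dvd_gcd (by omega) (by omega)
    rw [h] at this
    omega
  have h1 := Nat.mul_div_cancel' hev
  rw [halfProd]
  calc (2 * (((s - 1) * (t - 1) / 2 : ℕ) : ℤ)) = ((2 * ((s - 1) * (t - 1) / 2) : ℕ) : ℤ) := by
        push_cast; rfl
    _ = ((s : ℤ) - 1) * (t - 1) := by
        rw [h1, Nat.cast_mul, Nat.cast_sub (by omega), Nat.cast_sub (by omega), Nat.cast_one]

theorem two_mul_choose_two (s : ℕ) : 2 * (s.choose 2 : ℤ) = s * (s - 1) := by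
  have h := Finset.sum_range_id_mul_two s
  rw [Finset.sum_range_id, ← Nat.choose_two_right] at h
  rcases Nat.eq_zero_or_pos s with rfl | hs
  · simp
  · zify [show 1 ≤ s from hs] at h
    linarith

theorem exists_levelPos_eq {s t : ℕ} (h : s.Coprime t) (x : ℤ) :
    ∃ v, levelPos s t (levelIndex s t x) v = x := by
  obtain ⟨v, hv⟩ := Int.modEq_iff_dvd.1 (levelIndex_mul h x)
  exact ⟨v, by rw [levelPos]; linarith⟩

theorem levelPos_add_mul (s t : ℕ) (i v k : ℤ) :
    levelPos s t (i + s * k) v = levelPos s t i (v + t * k) := by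
  simp only [levelPos]
  ring

theorem levelPos_sub (s t : ℕ) (i v : ℤ) : levelPos s t i v - t = levelPos s t (i - 1) v := by
  simp only [levelPos]
  ring

theorem levelPos_strictMono {s : ℕ} (hs : 0 < s) (t : ℕ) (i : ℤ) :
    StrictMono (levelPos s t i) := by
  intro u v h
  have : (s : ℤ) * u < s * v := mul_lt_mul_of_pos_left h (by exact_mod_cast hs)
  simp only [levelPos]
  linarith

theorem levelPos_strictMono_left (s : ℕ) {t : ℕ} (ht : 0 < t) (v : ℤ) :
    StrictMono fun i => levelPos s t i v := by
  intro i j h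
  have : i * (t : ℤ) < j * t := mul_lt_mul_of_pos_right h (by exact_mod_cast ht)
  change i * (t : ℤ) - halfProd s t + s * v < j * t - halfProd s t + s * v
  linarith

theorem modEq_of_levelPos_modEq {s t : ℕ} (h : s.Coprime t) {i j u v : ℤ}
    (hij : levelPos s t i u ≡ levelPos s t j v [ZMOD s]) : i ≡ j [ZMOD s] := by
  apply modEq_of_mul_modEq h
  rw [Int.modEq_iff_dvd] at hij ⊢
  have := dvd_sub hij (dvd_mul_right (s : ℤ) (v - u))
  have e : j * (t : ℤ) - i * t = levelPos s t j v - levelPos s t i u - s * (v - u) := by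
    simp only [levelPos]
    ring
  rwa [e]

theorem levelIndex_levelPos {s t : ℕ} (h : s.Coprime t) (i v : ℤ) :
    levelIndex s t (levelPos s t i v) ≡ i [ZMOD s] := by
  obtain ⟨u, hu⟩ := exists_levelPos_eq h (levelPos s t i v)
  exact modEq_of_levelPos_modEq h (u := u) (v := v) (by rw [hu])

/-- This is the reason for the coordinates: the displacement of `w` is a function of the class of
`i`, so the level `t` action leaves `v` alone. -/
theorem levelAction_levelPos {s t : ℕ} (h : s.Coprime t) (w : AffineSym s) (i v : ℤ) :
    levelAction s t h w (levelPos s t i v) = levelPos s t ((w : Equiv.Perm ℤ) i) v := by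
  change levelFun s t w (levelPos s t i v) = _
  rw [levelFun, displacement_congr w (levelIndex_levelPos h i v)]
  simp only [levelPos]
  ring

/-- The sequence `y` describes the set `A` of integers. -/
def HasSeq (s t : ℕ) (A : Set ℤ) (y : ℤ → ℤ) : Prop :=
  ∀ i v, levelPos s t i v ∈ A ↔ v < y i

/-- The sequences that describe the beta-sets of the `s`-cores. -/
def levelSeq (s t : ℕ) : Set (ℤ → ℤ) :=
  {y | (∀ i, y (i + s) = y i - t) ∧ ∑ i ∈ Finset.range s, y i = 0}

theorem levelSeq_add_mul {s t : ℕ} {y : ℤ → ℤ} (hy : ∀ i, y (i + s) = y i - t) (k i : ℤ) :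
    y (i + s * k) = y i - t * k := by
  induction k using Int.induction_on generalizing i with
  | zero => simp
  | succ k ih =>
    have e : i + s * ((k : ℤ) + 1) = (i + s * k) + s := by ring
    rw [e, hy, ih]
    ring
  | pred k ih =>
    have h := hy (i + s * (-(k : ℤ) - 1))
    have e : i + s * (-(k : ℤ) - 1) + s = i + s * (-k) := by ring
    rw [e, ih] at h
    linarith

theorem levelPos_seq_congr {s t : ℕ} {y : ℤ → ℤ} (hy : ∀ i, y (i + s) = y i - t) {i j : ℤ}
    (h : i ≡ j [ZMOD s]) : levelPos s t i (y i) = levelPos s t j (y j) := by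
  obtain ⟨k, hk⟩ := Int.modEq_iff_dvd.1 h
  have e : j = i + s * k := by linarith
  rw [e, levelSeq_add_mul hy, levelPos_add_mul]
  congr 1
  ring

theorem HasSeq.eq {s t : ℕ} {A : Set ℤ} {y z : ℤ → ℤ} (hy : HasSeq s t A y)
    (hz : HasSeq s t A z) : y = z := by
  ext i
  apply eq_of_forall_lt_iff
  intro v
  rw [← hy, ← hz]

theorem HasSeq.set_eq {s t : ℕ} (h : s.Coprime t) {A A' : Set ℤ} {y : ℤ → ℤ}
    (hy : HasSeq s t A y) (hy' : HasSeq s t A' y) : A = A' := by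
  ext x
  obtain ⟨v, hv⟩ := exists_levelPos_eq h x
  rw [← hv, hy, hy']

theorem HasSeq.add {s t : ℕ} {A : Set ℤ} {y : ℤ → ℤ} (hy : HasSeq s t A y) (i : ℤ) :
    y (i + s) = y i - t := by
  apply eq_of_forall_lt_iff
  intro v
  have e := levelPos_add_mul s t i v 1
  rw [mul_one, mul_one] at e
  rw [← hy, e, hy]
  omega

theorem HasSeq.image {s t : ℕ} (h : s.Coprime t) {A : Set ℤ} {y : ℤ → ℤ} (hy : HasSeq s t A y)
    (w : AffineSym s) :
    HasSeq s t (levelAction s t h w '' A) fun i => y ((w⁻¹ : Equiv.Perm ℤ) i) := by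
  intro i v
  rw [← hy]
  have e := levelAction_levelPos h w ((w⁻¹ : Equiv.Perm ℤ) i) v
  have e' : (w : Equiv.Perm ℤ) ((w⁻¹ : Equiv.Perm ℤ) i) = i :=
    (w : Equiv.Perm ℤ).apply_symm_apply i
  rw [e'] at e
  rw [← e]
  exact (Equiv.injective _).mem_set_image

theorem sum_range_comp_of_modEq {s : ℕ} (hs : 0 < s) (g : ℤ → ℤ)
    (hg : ∀ a b, g a ≡ g b [ZMOD s] → a ≡ b [ZMOD s]) (f : ℤ → ℤ)
    (hf : ∀ a b, a ≡ b [ZMOD s] → f a = f b) :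
    ∑ m ∈ Finset.range s, f (g m) = ∑ m ∈ Finset.range s, f m := by
  have hs' : (0 : ℤ) < s := by exact_mod_cast hs
  have key : ∀ m : ℤ, ((m % s).toNat : ℤ) = m % s :=
    fun m => Int.toNat_of_nonneg (Int.emod_nonneg m hs'.ne')
  have hmaps : Set.MapsTo (fun m : ℕ => ((g m) % s).toNat)
      (Finset.range s : Finset ℕ) (Finset.range s : Finset ℕ) := by
    intro m _
    have := Int.emod_lt_of_pos (g m) hs'
    have h2 := key (g m)
    simp only [Finset.coe_range, Set.mem_Iio]
    omega
  have hinj : Set.InjOn (fun m : ℕ => ((g m) % s).toNat) (Finset.range s : Finset ℕ) := by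
    intro a ha b hb hab
    simp only [Finset.coe_range, Set.mem_Iio] at ha hb
    have h1 : g a % s = g b % s := by
      rw [← key (g a), ← key (g b)]; exact_mod_cast hab
    have h3 : (a : ℤ) % s = b % s := hg _ _ h1
    rw [Int.emod_eq_of_lt (by omega) (by omega), Int.emod_eq_of_lt (by omega) (by omega)] at h3
    exact_mod_cast h3
  refine Finset.sum_nbij (fun m : ℕ => ((g m) % s).toNat) hmaps hinj
    (Finset.surjOn_of_injOn_of_card_le _ hmaps hinj le_rfl) fun m _ => ?_
  rw [key]
  exact hf _ _ (Int.mod_modEq _ _).symm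

/-- The shift `(s - 1)(t - 1) / 2` is exactly the one for which the numbers `i t - c` with `0 ≤ i <
s` have the same sum as `0, …, s - 1`. -/
theorem sum_levelPos {s t : ℕ} (hs : 2 ≤ s) (h : s.Coprime t) (y : ℤ → ℤ) :
    ∑ i ∈ Finset.range s, levelPos s t i (y i) = s.choose 2 + s * ∑ i ∈ Finset.range s, y i := by
  simp only [levelPos, Finset.sum_add_distrib, Finset.sum_sub_distrib, ← Finset.mul_sum,
    ← Finset.sum_mul, sum_range_cast, Finset.sum_const, Finset.card_range, nsmul_eq_mul]
  have h1 := two_mul_halfProd hs h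
  have h2 := two_mul_choose_two s
  have h3 : 2 * ((s.choose 2 : ℤ) * t - s * halfProd s t) = 2 * s.choose 2 := by
    linear_combination (t - 1 : ℤ) * h2 - s * h1
  linarith

/-- The least missing integers of the classes are summed in two ways: over the indices `i` by
`sum_levelPos`, and over the residues `r`, where the coefficient of `s` is the charge. -/
theorem HasSeq.hasCharge {s t : ℕ} (hs : 2 ≤ s) (h : s.Coprime t) {A : Set ℤ} {y : ℤ → ℤ}
    (hy : HasSeq s t A y) : HasCharge A (∑ i ∈ Finset.range s, y i) := by
  have hs0 : 0 < s := by omega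
  choose v hv using fun x => exists_levelPos_eq h x
  have hq := hasCharge_of_classes hs0 (A := A)
    (q := fun r => y (levelIndex s t r) - v r) (by
      intro r _ u
      conv_lhs => rw [← hv r]
      have e : levelPos s t (levelIndex s t r) (v r) + s * u =
          levelPos s t (levelIndex s t r) (v r + u) := by
        simp only [levelPos]
        ring
      rw [e, hy]
      omega)
  convert hq using 1
  have h1 : ∑ r ∈ Finset.range s, levelPos s t (levelIndex s t r) (y (levelIndex s t r)) =
      ∑ i ∈ Finset.range s, levelPos s t i (y i) := by
    refine sum_range_comp_of_modEq hs0 (levelIndex s t) (fun a b hab => ?_)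
      (fun i => levelPos s t i (y i)) fun a b hab => levelPos_seq_congr hy.add hab
    have h2 := ((levelIndex_mul h a).symm.trans (hab.mul_right t)).trans (levelIndex_mul h b)
    simpa using h2.sub_right (halfProd s t)
  have h2 : ∀ r : ℕ, levelPos s t (levelIndex s t r) (y (levelIndex s t r)) =
      r + s * (y (levelIndex s t r) - v r) := by
    intro r
    have e := hv r
    simp only [levelPos] at e ⊢
    linarith
  rw [sum_levelPos hs h] at h1
  simp only [h2, Finset.sum_add_distrib, sum_range_cast, ← Finset.mul_sum] at h1
  have h3 : (s : ℤ) * ∑ i ∈ Finset.range s, y i =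
      s * ∑ r ∈ Finset.range s, (y (levelIndex s t r) - v r) := by linarith
  exact mul_left_cancel₀ (by exact_mod_cast hs0.ne') h3

theorem exists_bound_of_modEq {s : ℕ} (hs : 0 < s) (f : ℤ → ℤ)
    (hf : ∀ a b, a ≡ b [ZMOD s] → f a = f b) : ∃ M : ℕ, ∀ i, |f i| ≤ M := by
  refine ⟨∑ m ∈ Finset.range s, (f m).natAbs, fun i => ?_⟩
  have hs' : (0 : ℤ) < s := by exact_mod_cast hs
  have h0 := Int.emod_nonneg i hs'.ne'
  have h1 := Int.emod_lt_of_pos i hs'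
  have h2 := Finset.single_le_sum (f := fun m : ℕ => (f m).natAbs) (fun _ _ => Nat.zero_le _)
    (Finset.mem_range.2 (show (i % s).toNat < s by omega))
  have h3 : f i = f ((i % s).toNat : ℕ) := hf _ _ (by
    rw [Int.toNat_of_nonneg h0]
    exact (Int.mod_modEq _ _).symm)
  rw [h3, Int.abs_eq_natAbs]
  exact_mod_cast h2

theorem exists_Iio_of_lower {A : Set ℤ} (h : ∀ x ∈ A, x - 1 ∈ A) (h1 : ∃ x, x ∈ A) {M : ℤ}
    (h2 : ∀ x ∈ A, x < M) : ∃ p, A = Set.Iio p := by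
  have hlow : ∀ x ∈ A, ∀ n : ℕ, x - n ∈ A := by
    intro x hx n
    induction n with
    | zero => simpa using hx
    | succ n ih =>
      have := h _ ih
      push_cast
      rwa [← sub_sub]
  have hlow' : ∀ x ∈ A, ∀ y ≤ x, y ∈ A := by
    intro x hx y hy
    have := hlow x hx (x - y).toNat
    rwa [Int.toNat_of_nonneg (by omega), sub_sub_cancel] at this
  obtain ⟨m, hm, hm'⟩ := Int.exists_greatest_of_bdd (P := (· ∈ A)) ⟨M, fun x hx => (h2 x hx).le⟩ h1
  refine ⟨m + 1, Set.ext fun x => ⟨fun hx => ?_, fun hx => hlow' m hm x ?_⟩⟩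
  · have := hm' x hx
    simp only [Set.mem_Iio]
    omega
  · simp only [Set.mem_Iio] at hx
    omega

/-- Subtracting `s` lowers `v` by one, so for an `s`-core the admissible `v` form a down-set; it is
nonempty and bounded above, hence a half-line. -/
theorem exists_hasSeq {s : ℕ} (hs : 0 < s) (t : ℕ) {la : YoungDiagram} (hla : IsCore s la) :
    ∃ y, HasSeq s t (betaSet la) y := by
  rw [isCore_iff hs] at hla
  obtain ⟨M, h1, h2⟩ := exists_bound_betaSet la
  have : ∀ i, ∃ p, {v | levelPos s t i v ∈ betaSet la} = Set.Iio p := by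
    intro i
    have hle : ∀ k : ℤ, 0 ≤ k → k ≤ s * k := fun k hk =>
      le_mul_of_one_le_left hk (by exact_mod_cast hs)
    refine exists_Iio_of_lower (M := M + |i * t - halfProd s t|) (fun v hv => ?_) ?_ fun v hv => ?_
    · have e : levelPos s t i (v - 1) = levelPos s t i v - s := by
        simp only [levelPos]
        ring
      rw [Set.mem_ofPred_eq, e]
      exact hla _ hv
    · refine ⟨-(M + |i * t - halfProd s t| + 1), h2 _ ?_⟩
      have := hle (M + |i * t - halfProd s t| + 1) (by positivity)
      have := le_abs_self (i * t - halfProd s t)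
      simp only [levelPos]
      linarith
    · have h3 := h1 _ hv
      have := neg_abs_le (i * t - halfProd s t)
      simp only [levelPos] at h3
      by_contra h4
      have h5 := hle v (by
        have := abs_nonneg (i * t - halfProd s t)
        omega)
      linarith
  choose y hy using this
  exact ⟨y, fun i v => by simpa using Set.ext_iff.1 (hy i) v⟩

theorem HasSeq.isCore {s t : ℕ} (hs : 0 < s) (h : s.Coprime t) {la : YoungDiagram} {y : ℤ → ℤ}
    (hy : HasSeq s t (betaSet la) y) : IsCore s la := by
  rw [isCore_iff hs]
  intro b hb
  obtain ⟨v, hv⟩ := exists_levelPos_eq h b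
  rw [← hv, hy] at hb
  have e : b - s = levelPos s t (levelIndex s t b) (v - 1) := by
    conv_lhs => rw [← hv]
    simp only [levelPos]
    ring
  rw [e, hy]
  omega

theorem HasSeq.mem_levelSeq {s t : ℕ} (hs : 2 ≤ s) (h : s.Coprime t) {la : YoungDiagram}
    {y : ℤ → ℤ} (hy : HasSeq s t (betaSet la) y) : y ∈ levelSeq s t :=
  ⟨hy.add, (hy.hasCharge hs h).eq (hasCharge_betaSet la)⟩

theorem exists_betaSet_hasSeq {s t : ℕ} (hs : 2 ≤ s) (h : s.Coprime t) {y : ℤ → ℤ}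
    (hy : y ∈ levelSeq s t) : ∃ la, HasSeq s t (betaSet la) y := by
  have hs0 : 0 < s := by omega
  obtain ⟨hadd, hsum⟩ := hy
  set A : Set ℤ := {x | ∃ i v, levelPos s t i v = x ∧ v < y i} with hA
  have hmem : ∀ i v, levelPos s t i v ∈ A ↔ levelPos s t i v < levelPos s t i (y i) := by
    intro i v
    constructor
    · rintro ⟨j, u, hx, hu⟩
      have hij := modEq_of_levelPos_modEq h (i := j) (j := i) (u := u) (v := v) (by rw [hx])
      rw [← hx, ← levelPos_seq_congr hadd hij]
      exact levelPos_strictMono hs0 t j hu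
    · intro hv
      exact ⟨i, v, rfl, (levelPos_strictMono hs0 t i).lt_iff_lt.1 hv⟩
  have hseq : HasSeq s t A y := fun i v => by
    rw [hmem, (levelPos_strictMono hs0 t i).lt_iff_lt]
  have hch := hseq.hasCharge hs h
  rw [hsum] at hch
  obtain ⟨M, hM⟩ := exists_bound_of_modEq hs0 (fun i => levelPos s t i (y i))
    fun a b hab => levelPos_seq_congr hadd hab
  have hM' := fun i => abs_le.1 (hM i)
  obtain ⟨la, hla⟩ := exists_betaSet_eq hch (M := M) (by
      rintro x ⟨i, v, rfl, hv⟩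
      exact (levelPos_strictMono hs0 t i hv).trans_le (hM' i).2) (by
      intro x hx
      obtain ⟨v, hv⟩ := exists_levelPos_eq h x
      rw [← hv, hmem, hv]
      exact hx.trans_le (hM' _).1)
  exact ⟨la, hla ▸ hseq⟩

/-- The function `s y i + t i` is `s`-periodic, so its sum over a period is unchanged by `w`; the
sum of the `i` is unchanged too, by the normalisation of `w`. -/
theorem comp_mem_levelSeq {s t : ℕ} (hs : 0 < s) {y : ℤ → ℤ} (hy : y ∈ levelSeq s t)
    (w : AffineSym s) : (fun i => y ((w : Equiv.Perm ℤ) i)) ∈ levelSeq s t := by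
  refine ⟨fun i => by simp only [w.2.1 i, hy.1], ?_⟩
  have h := sum_range_comp_of_periodic (w : Equiv.Perm ℤ) w.2.1 (fun i => s * y i + t * i)
    (fun i => by rw [hy.1]; ring)
  simp only [Finset.sum_add_distrib, ← Finset.mul_sum, hy.2, w.2.2, sum_range_cast] at h
  have h0 : (s : ℤ) * ∑ i ∈ Finset.range s, y ((w : Equiv.Perm ℤ) i) = 0 := by linarith
  exact (mul_eq_zero.1 h0).resolve_left (by exact_mod_cast hs.ne')

/-- Subtracting `t` lowers `i` by one, so closure under it says that `v < y i` implies `v < y (i -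
1)`. -/
theorem HasSeq.isCore_iff_antitone {s t : ℕ} (ht : 0 < t) (h : s.Coprime t)
    {la : YoungDiagram} {y : ℤ → ℤ} (hy : HasSeq s t (betaSet la) y) :
    IsCore t la ↔ Antitone y := by
  rw [isCore_iff ht]
  constructor
  · intro hc
    refine antitone_int_of_succ_le fun i => ?_
    by_contra hlt
    have h1 := hc _ ((hy (i + 1) (y i)).2 (by omega))
    rw [levelPos_sub, hy, add_sub_cancel_right] at h1
    omega
  · intro hanti b hb
    obtain ⟨v, hv⟩ := exists_levelPos_eq h b
    rw [← hv, hy] at hb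
    rw [← hv, levelPos_sub, hy]
    exact hb.trans_le (hanti (by omega))

/-! ### The `s`-set in terms of the sequence -/

theorem HasSeq.mem_sSet_iff {s t : ℕ} (hs : 0 < s) (h : s.Coprime t) {la : YoungDiagram}
    {y : ℤ → ℤ} (hy : HasSeq s t (betaSet la) y) {x : ℤ} :
    x ∈ sSet s la ↔ x = levelPos s t (levelIndex s t x) (y (levelIndex s t x)) := by
  obtain ⟨v, hv⟩ := exists_levelPos_eq h x
  set i := levelIndex s t x with hi
  have hleast : IsLeast {b | b ≡ x [ZMOD s] ∧ b ∉ betaSet la} (levelPos s t i (y i)) := by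
    refine ⟨⟨?_, by rw [hy]; exact lt_irrefl _⟩, ?_⟩
    · rw [← hv, Int.modEq_iff_dvd]
      exact ⟨v - y i, by simp only [levelPos]; ring⟩
    · rintro b ⟨hb, hb'⟩
      obtain ⟨k, hk⟩ := Int.modEq_iff_dvd.1 hb
      have e : b = levelPos s t i (v - k) := by
        simp only [levelPos] at hv ⊢
        linarith
      rw [e, hy, not_lt] at hb'
      rw [e]
      exact (levelPos_strictMono hs t i).monotone hb'
  constructor
  · intro hx
    exact IsLeast.unique hx hleast
  · intro hx
    change IsLeast _ x
    rwa [← hx] at hleast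

theorem HasSeq.levelPos_mem_sSet {s t : ℕ} (hs : 0 < s) (h : s.Coprime t) {la : YoungDiagram}
    {y : ℤ → ℤ} (hy : HasSeq s t (betaSet la) y) (i : ℤ) : levelPos s t i (y i) ∈ sSet s la := by
  rw [hy.mem_sSet_iff hs h]
  exact levelPos_seq_congr hy.add (levelIndex_levelPos h i _).symm

/-- The condition on the sequence of an `s`-core that its `s`-set has spread less than `N s`. -/
def SmallSpread (s t N : ℕ) (y : ℤ → ℤ) : Prop :=
  ∀ i j, levelPos s t i (y i) - levelPos s t j (y j) < N * s

theorem HasSeq.smallSpread_iff {s t N : ℕ} (hs : 0 < s) (h : s.Coprime t) {la : YoungDiagram}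
    {y : ℤ → ℤ} (hy : HasSeq s t (betaSet la) y) :
    (∀ k ∈ sSet s la, ∀ l ∈ sSet s la, k - l < N * s) ↔ SmallSpread s t N y := by
  constructor
  · intro H i j
    exact H _ (hy.levelPos_mem_sSet hs h i) _ (hy.levelPos_mem_sSet hs h j)
  · intro H k hk l hl
    rw [hy.mem_sSet_iff hs h] at hk hl
    rw [hk, hl]
    exact H _ _

/-- A bijection preserving residues modulo `N s` preserves classes modulo `s`, so it must match the
elements of equal index `i`, whose difference is `s (z i - y i)`. -/
theorem HasSeq.coreCongr_iff {s t N : ℕ} (hs : 0 < s) (h : s.Coprime t) {la mu : YoungDiagram}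
    {y z : ℤ → ℤ} (hy : HasSeq s t (betaSet la) y) (hz : HasSeq s t (betaSet mu) z) :
    CoreCongr s N la mu ↔ ∀ i, y i ≡ z i [ZMOD N] := by
  have hs' : (s : ℤ) ≠ 0 := by exact_mod_cast hs.ne'
  constructor
  · rintro ⟨f, hf⟩ i
    set k : sSet s la := ⟨_, hy.levelPos_mem_sSet hs h i⟩ with hk
    have h1 := hf k
    have h2 := (hz.mem_sSet_iff hs h).1 (f k).2
    rw [h2] at h1
    have h3 : levelIndex s t (f k) ≡ i [ZMOD s] := by
      refine modEq_of_levelPos_modEq h (h1.of_dvd ?_)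
      push_cast
      exact dvd_mul_left _ _
    rw [levelPos_seq_congr hz.add h3] at h1
    have h4 := Int.modEq_iff_dvd.1 h1.symm
    rw [Int.modEq_iff_dvd]
    have e : levelPos s t i (z i) - levelPos s t i (y i) = (z i - y i) * s := by
      simp only [levelPos]
      ring
    rw [e] at h4
    push_cast at h4
    exact (mul_dvd_mul_iff_right hs').1 h4
  · intro H
    have hmaps : ∀ {y z : ℤ → ℤ} {la mu : YoungDiagram}, HasSeq s t (betaSet la) y →
        HasSeq s t (betaSet mu) z → ∀ k ∈ sSet s la,
        levelPos s t (levelIndex s t k) (z (levelIndex s t k)) ∈ sSet s mu := by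
      intro y z la mu _ hz k _
      exact hz.levelPos_mem_sSet hs h _
    have hinv : ∀ {y z : ℤ → ℤ} {la mu : YoungDiagram} (hy : HasSeq s t (betaSet la) y)
        (hz : HasSeq s t (betaSet mu) z), ∀ k ∈ sSet s la,
        levelPos s t (levelIndex s t (levelPos s t (levelIndex s t k) (z (levelIndex s t k))))
          (y (levelIndex s t (levelPos s t (levelIndex s t k) (z (levelIndex s t k))))) = k := by
      intro y z la mu hy hz k hk
      rw [levelPos_seq_congr hy.add (levelIndex_levelPos h _ _)]
      exact ((hy.mem_sSet_iff hs h).1 hk).symm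
    refine ⟨⟨fun k => ⟨_, hmaps hy hz k k.2⟩, fun k => ⟨_, hmaps hz hy k k.2⟩,
      fun k => Subtype.ext (hinv hy hz k k.2), fun k => Subtype.ext (hinv hz hy k k.2)⟩, ?_⟩
    rintro ⟨k, hk⟩
    rw [hy.mem_sSet_iff hs h] at hk
    simp only [Equiv.coe_fn_mk]
    set i := levelIndex s t k
    conv_rhs => rw [hk]
    rw [Int.modEq_iff_dvd]
    have e : levelPos s t i (y i) - levelPos s t i (z i) = (y i - z i) * s := by
      simp only [levelPos]
      ring
    rw [e]
    push_cast
    exact mul_dvd_mul_right (Int.modEq_iff_dvd.1 (H i).symm) _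

/-! ### Representatives of the congruence classes and of the orbits -/

theorem dvd_sub_add_iff (s : ℕ) (k i : ℤ) : (s : ℤ) ∣ k + s - i ↔ (s : ℤ) ∣ k - i := by
  rw [show k + s - i = (k - i) + s by ring]
  exact dvd_add_self_right

theorem modEq_of_dvd_sub {s : ℕ} {k i : ℤ} (h : (s : ℤ) ∣ k - i) : k ≡ i [ZMOD s] :=
  (Int.modEq_iff_dvd.2 h).symm

/-- Descent on the sum of squares of the `s`-set: if two elements differ by too much, the larger is
lowered and the smaller raised by `N s`. This keeps the total and the residues, and lowers the sum
of squares by `2 N s` times the excess of the difference over `N s`. -/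
theorem exists_smallSpread {s t N : ℕ} (hs : 2 ≤ s) (h : s.Coprime t) (hN : 0 < N) {y : ℤ → ℤ}
    (hy : y ∈ levelSeq s t) :
    ∃ z ∈ levelSeq s t, SmallSpread s t N z ∧ ∀ i, y i ≡ z i [ZMOD N] := by
  have hs0 : 0 < s := by omega
  induction hm : (∑ k ∈ Finset.range s, levelPos s t k (y k) ^ 2).toNat
    using Nat.strong_induction_on generalizing y with
  | _ m ih =>
    by_cases hsp : SmallSpread s t N y
    · exact ⟨y, hy, hsp, fun _ => Int.ModEq.refl _⟩
    simp only [SmallSpread, not_forall, not_lt] at hsp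
    obtain ⟨i, j, hij⟩ := hsp
    have hNs : (0 : ℤ) < N * s := by positivity
    have hne : ¬ i ≡ j [ZMOD s] := fun e => by
      rw [levelPos_seq_congr hy.1 e, sub_self] at hij
      linarith
    -- Equality would put both elements in one class modulo `s`; strictness is what makes the
    -- descent terminate.
    have hlt : (N : ℤ) * s < levelPos s t i (y i) - levelPos s t j (y j) := by
      refine lt_of_le_of_ne hij fun e => hne ?_
      refine modEq_of_levelPos_modEq h (u := y i) (v := y j) (Int.modEq_iff_dvd.2 ?_).symm
      rw [← e]
      exact dvd_mul_left _ _
    let z : ℤ → ℤ := fun k => y k + ((if (s : ℤ) ∣ k - i then -(N : ℤ) else 0) +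
      if (s : ℤ) ∣ k - j then (N : ℤ) else 0)
    have hz : z ∈ levelSeq s t := by
      constructor
      · intro k
        simp only [z, dvd_sub_add_iff, hy.1]
        ring
      · simp only [z, Finset.sum_add_distrib, hy.2, sum_range_ite_dvd hs0]
        ring
    have hsq : ∀ k : ℤ, levelPos s t k (z k) ^ 2 = levelPos s t k (y k) ^ 2 +
        ((if (s : ℤ) ∣ k - i then -2 * (N * s) * levelPos s t i (y i) + (N * s) ^ 2 else 0) +
          if (s : ℤ) ∣ k - j then 2 * (N * s) * levelPos s t j (y j) + (N * s) ^ 2 else 0) := by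
      intro k
      simp only [z]
      by_cases hi : (s : ℤ) ∣ k - i
      · have hj : ¬ (s : ℤ) ∣ k - j := fun hj =>
          hne ((modEq_of_dvd_sub hi).symm.trans (modEq_of_dvd_sub hj))
        rw [← levelPos_seq_congr hy.1 (modEq_of_dvd_sub hi)]
        simp only [if_pos hi, if_neg hj, levelPos]
        ring
      · by_cases hj : (s : ℤ) ∣ k - j
        · rw [← levelPos_seq_congr hy.1 (modEq_of_dvd_sub hj)]
          simp only [if_neg hi, if_pos hj, levelPos]
          ring
        · simp only [if_neg hi, if_neg hj, add_zero]
    have hsum : ∑ k ∈ Finset.range s, levelPos s t k (z k) ^ 2 =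
        ∑ k ∈ Finset.range s, levelPos s t k (y k) ^ 2 -
          2 * (N * s) * (levelPos s t i (y i) - levelPos s t j (y j) - N * s) := by
      simp only [hsq, Finset.sum_add_distrib, sum_range_ite_dvd hs0]
      ring
    have hpos : 0 < 2 * ((N : ℤ) * s) * (levelPos s t i (y i) - levelPos s t j (y j) - N * s) :=
      mul_pos (by positivity) (by linarith)
    have hnn : 0 ≤ ∑ k ∈ Finset.range s, levelPos s t k (z k) ^ 2 :=
      Finset.sum_nonneg fun _ _ => sq_nonneg _
    obtain ⟨x, hx, hx', hzx⟩ := ih _ (by omega) hz rfl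
    refine ⟨x, hx, hx', fun k => Int.ModEq.trans ?_ (hzx k)⟩
    rw [Int.modEq_iff_dvd]
    simp only [z, add_sub_cancel_left]
    split_ifs <;> simp

/-- Write `z - y = N q` with `q` periodic of sum zero. If `q i > 0 > q j`, the difference of the two
`s`-set elements grows by at least `2 N s`, but it lies in `(-N s, N s)` both before and after. So
`q` has constant sign, hence vanishes. -/
theorem SmallSpread.eq {s t N : ℕ} (hs : 2 ≤ s) (hN : 0 < N) {y z : ℤ → ℤ}
    (hy : y ∈ levelSeq s t) (hz : z ∈ levelSeq s t) (hy' : SmallSpread s t N y)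
    (hz' : SmallSpread s t N z) (h : ∀ i, y i ≡ z i [ZMOD N]) : y = z := by
  have hs0 : 0 < s := by omega
  have hNs : (0 : ℤ) < N * s := by positivity
  choose q hq using fun i => Int.modEq_iff_dvd.1 (h i)
  have key : ∀ i j, ¬ (0 < q i ∧ q j < 0) := by
    rintro i j ⟨hi, hj⟩
    have h1 := hz' i j
    have h2 := hy' j i
    have e : ∀ i, levelPos s t i (z i) = levelPos s t i (y i) + N * s * q i := by
      intro i
      have := hq i
      simp only [levelPos]
      linear_combination s * this
    rw [e i, e j] at h1
    have h3 : (N * s : ℤ) * 2 ≤ N * s * (q i - q j) := mul_le_mul_of_nonneg_left (by omega) hNs.le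
    linarith
  have hqs : ∀ i, q (i + s) = q i := by
    intro i
    have h1 := hq (i + s)
    rw [hy.1, hz.1] at h1
    have h2 := hq i
    have h3 : (N : ℤ) * q (i + s) = N * q i := by linarith
    exact mul_left_cancel₀ (by exact_mod_cast hN.ne') h3
  have hsum : ∑ i ∈ Finset.range s, q i = 0 := by
    have h1 : ∑ i ∈ Finset.range s, (z i - y i) = 0 := by
      rw [Finset.sum_sub_distrib, hy.2, hz.2, sub_zero]
    simp only [hq, ← Finset.mul_sum] at h1
    exact (mul_eq_zero.1 h1).resolve_left (by exact_mod_cast hN.ne')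
  have hqm : ∀ i : ℤ, q i = q ((i % s).toNat : ℕ) := by
    intro i
    rw [Int.toNat_of_nonneg (Int.emod_nonneg i (by exact_mod_cast hs0.ne'))]
    have h1 := periodic_add_mul q hqs (i / s) (i % s)
    rwa [Int.emod_add_mul_ediv] at h1
  have hmem : ∀ i : ℤ, (i % s).toNat ∈ Finset.range s := by
    intro i
    have h1 := Int.emod_lt_of_pos i (by exact_mod_cast hs0 : (0 : ℤ) < s)
    have h0 := Int.emod_nonneg i (by exact_mod_cast hs0.ne' : (s : ℤ) ≠ 0)
    rw [Finset.mem_range]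
    omega
  have hzero : ∀ i, q i = 0 := by
    intro i
    by_cases hneg : ∃ j, q j < 0
    · obtain ⟨j, hj⟩ := hneg
      have hle : ∀ k ∈ Finset.range s, q (k : ℕ) ≤ 0 := fun k _ => by
        have := key k j
        omega
      rw [hqm]
      exact (Finset.sum_eq_zero_iff_of_nonpos hle).1 hsum _ (hmem i)
    · push Not at hneg
      rw [hqm]
      exact (Finset.sum_eq_zero_iff_of_nonneg fun (k : ℕ) _ => hneg k).1 hsum _ (hmem i)
  ext i
  have h1 := hq i
  rw [hzero, mul_zero] at h1
  linarith

/-- Take `i` in `[j, j + s)`: then `y i ≤ y j`, while the term `i t` exceeds `j t` by less than `s t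
≤ N s`. -/
theorem smallSpread_of_antitone {s t N : ℕ} (hs : 0 < s) (ht : 0 < t) (hN : t ≤ N) {y : ℤ → ℤ}
    (hy : y ∈ levelSeq s t) (hanti : Antitone y) : SmallSpread s t N y := by
  intro i j
  have hs' : (0 : ℤ) < s := by exact_mod_cast hs
  have h0 := Int.emod_nonneg (i - j) hs'.ne'
  have h1 := Int.emod_lt_of_pos (i - j) hs'
  have h2 : i ≡ j + (i - j) % s [ZMOD s] := by
    have := (Int.mod_modEq (i - j) s).symm.add_left j
    simpa using this
  rw [levelPos_seq_congr hy.1 h2]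
  have h3 : y (j + (i - j) % s) ≤ y j := hanti (by omega)
  have h4 : (s : ℤ) * y (j + (i - j) % s) ≤ s * y j := mul_le_mul_of_nonneg_left h3 hs'.le
  have h5 : (i - j) % s * t < s * t := mul_lt_mul_of_pos_right h1 (by exact_mod_cast ht)
  have h6 : (s : ℤ) * t ≤ s * N := mul_le_mul_of_nonneg_left (by exact_mod_cast hN) hs'.le
  simp only [levelPos]
  linarith

/-- Sorting by adjacent transpositions. Swapping an ascent at `i`, periodically, lowers the sum of
squares of the `s`-set by `2 t s (y (i + 1) - y i)`, so the process stops. -/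
theorem exists_antitone {s t : ℕ} (hs : 2 ≤ s) (h : s.Coprime t) {y : ℤ → ℤ}
    (hy : y ∈ levelSeq s t) : ∃ w : AffineSym s, Antitone fun i => y ((w : Equiv.Perm ℤ) i) := by
  have hs0 : 0 < s := by omega
  have ht := pos_of_coprime hs h
  induction hm : (∑ k ∈ Finset.range s, levelPos s t k (y k) ^ 2).toNat
    using Nat.strong_induction_on generalizing y with
  | _ m ih =>
    by_cases hanti : ∀ i, y (i + 1) ≤ y i
    · exact ⟨1, by simpa using antitone_int_of_succ_le hanti⟩
    push Not at hanti
    obtain ⟨i, hi⟩ := hanti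
    set r := simpleReflection s hs (i + 1) with hr
    have hrr : ∀ k, (r : Equiv.Perm ℤ) ((r : Equiv.Perm ℤ) k) = k :=
      levelGenerator_one_involutive hs (i + 1)
    have hrs := r.2.1
    have h1 : ¬ (s : ℤ) ∣ 1 := by
      intro h
      have := Int.le_of_dvd one_pos h
      omega
    have hsq : ∀ k : ℤ, levelPos s t ((r : Equiv.Perm ℤ) k) (y k) ^ 2 = levelPos s t k (y k) ^ 2 +
        ((if (s : ℤ) ∣ k - i then 2 * t * levelPos s t i (y i) + t ^ 2 else 0) +
        if (s : ℤ) ∣ k - (i + 1) then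
          -2 * t * levelPos s t (i + 1) (y (i + 1)) + t ^ 2 else 0) := by
      intro k
      rw [hr, simpleReflection_apply, levelGenerator_one, show i + 1 - 1 = i by ring]
      by_cases ha : (s : ℤ) ∣ k - i
      · have hb : ¬ (s : ℤ) ∣ k - (i + 1) := fun h =>
          h1 (by have := dvd_sub ha h; ring_nf at this; exact this)
        rw [← levelPos_seq_congr hy.1 (modEq_of_dvd_sub ha)]
        simp only [if_pos ha, if_neg hb, levelPos]
        ring
      · by_cases hb : (s : ℤ) ∣ k - (i + 1)
        · rw [← levelPos_seq_congr hy.1 (modEq_of_dvd_sub hb)]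
          simp only [if_neg ha, if_pos hb, levelPos]
          ring
        · simp only [if_neg ha, if_neg hb, add_zero]
    have hperiodic : ∀ k, levelPos s t ((r : Equiv.Perm ℤ) (k + s)) (y (k + s)) ^ 2 =
        levelPos s t ((r : Equiv.Perm ℤ) k) (y k) ^ 2 := by
      intro k
      rw [hrs, hy.1]
      congr 1
      simp only [levelPos]
      ring
    have hsum : ∑ k ∈ Finset.range s, levelPos s t k (y ((r : Equiv.Perm ℤ) k)) ^ 2 =
        ∑ k ∈ Finset.range s, levelPos s t k (y k) ^ 2 - 2 * t * s * (y (i + 1) - y i) := by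
      have e := sum_range_comp_of_periodic (r : Equiv.Perm ℤ) hrs
        (fun k => levelPos s t ((r : Equiv.Perm ℤ) k) (y k) ^ 2) hperiodic
      simp only [hrr] at e
      rw [e]
      simp only [hsq, Finset.sum_add_distrib, sum_range_ite_dvd hs0]
      simp only [levelPos]
      ring
    have hpos : 0 < 2 * (t : ℤ) * s * (y (i + 1) - y i) :=
      mul_pos (by positivity) (by linarith)
    have hnn : 0 ≤ ∑ k ∈ Finset.range s, levelPos s t k (y ((r : Equiv.Perm ℤ) k)) ^ 2 :=
      Finset.sum_nonneg fun _ _ => sq_nonneg _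
    obtain ⟨w, hw⟩ := ih _ (by omega) (comp_mem_levelSeq hs0 hy r) rfl
    exact ⟨r * w, hw⟩

/-! ### Translations -/

/-- The element `i ↦ i + s q(i)` of the affine symmetric group. -/
def translation {s : ℕ} (q : ℤ → ℤ) (hq : ∀ i, q (i + s) = q i)
    (hsum : ∑ i ∈ Finset.range s, q i = 0) : AffineSym s :=
  ⟨{ toFun := fun i => i + s * q i
     invFun := fun i => i - s * q i
     left_inv := fun i => by
       simp only [periodic_add_mul q hq (q i) i, add_sub_cancel_right]
     right_inv := fun i => by
       have := periodic_add_mul q hq (-q i) i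
       rw [mul_neg, ← sub_eq_add_neg] at this
       simp only [this, sub_add_cancel] },
   fun i => by
     simp only [Equiv.coe_fn_mk, hq]
     ring, by
     simp only [Equiv.coe_fn_mk, Finset.sum_add_distrib, ← Finset.mul_sum, hsum, sum_range_cast]
     ring⟩

theorem translation_apply {s : ℕ} (q : ℤ → ℤ) (hq : ∀ i, q (i + s) = q i)
    (hsum : ∑ i ∈ Finset.range s, q i = 0) (i : ℤ) :
    (translation q hq hsum : Equiv.Perm ℤ) i = i + s * q i := rfl

/-- Adding `s k` to the index lowers `y` by `t k`. So a difference `n t q i` is realised by the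
shift `-s n q i`; here it matters that the modulus is a multiple of `t`. -/
theorem exists_translation_of_modEq {s t n : ℕ} (ht : 0 < t) (hn : 0 < n) {y z : ℤ → ℤ}
    (hy : y ∈ levelSeq s t) (hz : z ∈ levelSeq s t)
    (h : ∀ i, y i ≡ z i [ZMOD ((n * t : ℕ) : ℤ)]) :
    ∃ w : AffineSym s, (∀ i, i ≡ (w : Equiv.Perm ℤ) i [ZMOD ((n * s : ℕ) : ℤ)]) ∧
      ∀ i, z i = y ((w : Equiv.Perm ℤ) i) := by
  choose q hq using fun i => Int.modEq_iff_dvd.1 (h i)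
  have hnt : ((n * t : ℕ) : ℤ) ≠ 0 := by positivity
  have hn' : (n : ℤ) ≠ 0 := by positivity
  have hqs : ∀ i, -((n : ℤ) * q (i + s)) = -(n * q i) := by
    intro i
    have h1 := hq (i + s)
    rw [hy.1, hz.1] at h1
    have h2 := hq i
    have h3 : ((n * t : ℕ) : ℤ) * q (i + s) = (n * t : ℕ) * q i := by linarith
    rw [mul_left_cancel₀ hnt h3]
  have hsum : ∑ i ∈ Finset.range s, -((n : ℤ) * q i) = 0 := by
    have h1 : ∑ i ∈ Finset.range s, (z i - y i) = 0 := by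
      rw [Finset.sum_sub_distrib, hy.2, hz.2, sub_zero]
    simp only [hq, ← Finset.mul_sum] at h1
    rw [Finset.sum_neg_distrib, ← Finset.mul_sum, (mul_eq_zero.1 h1).resolve_left hnt]
    ring
  refine ⟨translation (fun i => -(n * q i)) hqs hsum, fun i => ?_, fun i => ?_⟩
  · rw [translation_apply, Int.modEq_iff_dvd]
    exact ⟨-q i, by push_cast; ring⟩
  · rw [translation_apply, levelSeq_add_mul hy.1]
    have := hq i
    push_cast at this
    linarith

/-! ### Runners and `t`-cores -/

/-- The positions of the elements of `A` in one class modulo `t`. -/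
def runner (s t : ℕ) (A : Set ℤ) (v : ℤ) : Set ℤ := {i | levelPos s t i v ∈ A}

/-- Moving `b` to `b - t` stays in one class modulo `t`: a runner through `b` has one element moved
from `i` to `i - 1`, and every other runner is untouched. -/
theorem hasCharge_runner_iff_of_removes {s t : ℕ} (ht : 0 < t) {la mu : YoungDiagram}
    (h : RemovesRimHook t la mu) (v c : ℤ) :
    HasCharge (runner s t (betaSet mu) v) c ↔ HasCharge (runner s t (betaSet la) v) c := by
  obtain ⟨b, hb, hb', e⟩ := betaSet_of_removesRimHook h
  have hinj := (levelPos_strictMono_left s ht v).injective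
  by_cases hi : ∃ i, levelPos s t i v = b
  · obtain ⟨i, rfl⟩ := hi
    rw [levelPos_sub] at e hb'
    have hr : runner s t (betaSet mu) v = insert (i - 1) (runner s t (betaSet la) v \ {i}) := by
      ext j
      simp only [runner, e, Set.mem_ofPred_eq, Set.mem_insert_iff, Set.mem_sdiff,
        Set.mem_singleton_iff]
      rw [show levelPos s t j v = levelPos s t (i - 1) v ↔ j = i - 1 from hinj.eq_iff,
        show levelPos s t j v = levelPos s t i v ↔ j = i from hinj.eq_iff]
    rw [hr]
    exact hasCharge_move_iff hb hb'
  · have hr : runner s t (betaSet mu) v = runner s t (betaSet la) v := by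
      ext j
      have h1 : levelPos s t j v ≠ b := fun h => hi ⟨j, h⟩
      have h2 : levelPos s t j v ≠ b - t := fun h => hi ⟨j + 1, by
        rw [← add_sub_cancel_right j 1, ← levelPos_sub] at h
        linarith⟩
      simp [runner, e, h1, h2]
    rw [hr]

theorem IsCoreOf.hasCharge_runner_iff {s t : ℕ} (ht : 0 < t) {la mu : YoungDiagram}
    (h : IsCoreOf t mu la) (v c : ℤ) :
    HasCharge (runner s t (betaSet mu) v) c ↔ HasCharge (runner s t (betaSet la) v) c := by
  obtain ⟨-, h⟩ := h
  induction h with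
  | refl => rfl
  | tail _ h ih => rw [hasCharge_runner_iff_of_removes ht h, ih]

theorem IsCore.exists_runner_eq_Iio {t : ℕ} (s : ℕ) (ht : 0 < t) {la : YoungDiagram}
    (h : IsCore t la) (v : ℤ) : ∃ p, runner s t (betaSet la) v = Set.Iio p := by
  rw [isCore_iff ht] at h
  obtain ⟨M, h1, h2⟩ := exists_bound_betaSet la
  set c := |s * v - halfProd s t| with hc
  have hle : ∀ k : ℤ, 0 ≤ k → k ≤ k * t := fun k hk =>
    le_mul_of_one_le_right hk (by exact_mod_cast ht)
  have hc0 : 0 ≤ c := abs_nonneg _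
  have hc1 : s * v - halfProd s t ≤ c := le_abs_self _
  have hc2 : -c ≤ s * v - halfProd s t := neg_abs_le _
  refine exists_Iio_of_lower (M := M + c) (fun i hi => ?_) ⟨-(M + c + 1), h2 _ ?_⟩ fun i hi => ?_
  · rw [runner, Set.mem_ofPred_eq, ← levelPos_sub]
    exact h _ hi
  · have := hle (M + c + 1) (by positivity)
    simp only [levelPos]
    linarith
  · have h3 := h1 _ hi
    simp only [levelPos] at h3
    by_contra h4
    have h5 := hle i (by omega)
    linarith

/-- Every runner of a `t`-core is a half-line `Set.Iio p`, and `p` is its charge. -/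
theorem IsCore.eq_of_runners {s t : ℕ} (ht : 0 < t) (hst : s.Coprime t) {la mu : YoungDiagram}
    (hla : IsCore t la) (hmu : IsCore t mu)
    (h : ∀ v c, HasCharge (runner s t (betaSet la) v) c →
      HasCharge (runner s t (betaSet mu) v) c) : la = mu := by
  apply betaSet_injective
  ext x
  obtain ⟨v, hv⟩ := exists_levelPos_eq hst x
  obtain ⟨p, hp⟩ := hla.exists_runner_eq_Iio s ht v
  obtain ⟨p', hp'⟩ := hmu.exists_runner_eq_Iio s ht v
  have h1 := h v p (hp ▸ hasCharge_Iio p)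
  rw [hp'] at h1
  rw [h1.eq (hasCharge_Iio p'), ← hp'] at hp
  have := Set.ext_iff.1 hp (levelIndex s t x)
  simpa only [runner, Set.mem_ofPred_eq, hv] using this

/-- Runner `v` of `A'` is the image under `w` of runner `v` of `A`, and affine permutations preserve
charge. -/
theorem HasSeq.hasCharge_runner_comp {s t : ℕ} (hs : 2 ≤ s) {A A' : Set ℤ}
    {y z : ℤ → ℤ} (hy : HasSeq s t A y) (hz : HasSeq s t A' z) {w : AffineSym s}
    (hw : ∀ i, z ((w : Equiv.Perm ℤ) i) = y i) {v c : ℤ} (h : HasCharge (runner s t A v) c) :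
    HasCharge (runner s t A' v) c := by
  have e : runner s t A' v = (w : Equiv.Perm ℤ) '' runner s t A v := by
    ext i
    obtain ⟨j, rfl⟩ := (w : Equiv.Perm ℤ).surjective i
    rw [(w : Equiv.Perm ℤ).injective.mem_set_image]
    simp only [runner, Set.mem_ofPred_eq]
    rw [hy, hz, hw]
  rw [e]
  exact hasCharge_image_affineSym hs w h

/-! ### Indices of congruence subgroups -/

/-- The elements `w` of the affine symmetric group with `w i ≡ i` modulo `n s` for all `i`. -/
def congrSubgroup (s n : ℕ) : Subgroup (AffineSym s) where
  carrier := {w | ∀ i, i ≡ (w : Equiv.Perm ℤ) i [ZMOD ((n * s : ℕ) : ℤ)]}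
  one_mem' := fun _ => Int.ModEq.refl _
  mul_mem' := fun {_ w} hv hw i => (hw i).trans (hv ((w : Equiv.Perm ℤ) i))
  inv_mem' := fun {w} hw i => by
    have := hw ((w⁻¹ : Equiv.Perm ℤ) i)
    rw [show (w : Equiv.Perm ℤ) ((w⁻¹ : Equiv.Perm ℤ) i) = i from
      (w : Equiv.Perm ℤ).apply_symm_apply i] at this
    exact this.symm

theorem mem_congrSubgroup {s n : ℕ} {w : AffineSym s} :
    w ∈ congrSubgroup s n ↔ ∀ i, i ≡ (w : Equiv.Perm ℤ) i [ZMOD ((n * s : ℕ) : ℤ)] := Iff.rfl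

theorem modEq_apply_of_modEq {s n : ℕ} (w : AffineSym s) {a b : ℤ}
    (h : a ≡ b [ZMOD ((n * s : ℕ) : ℤ)]) :
    (w : Equiv.Perm ℤ) a ≡ (w : Equiv.Perm ℤ) b [ZMOD ((n * s : ℕ) : ℤ)] := by
  have h1 := displacement_congr w (h.of_dvd (by push_cast; exact dvd_mul_left _ _))
  rw [Int.modEq_iff_dvd] at h ⊢
  rwa [show (w : Equiv.Perm ℤ) b - (w : Equiv.Perm ℤ) a = b - a by linarith]

instance congrSubgroup_normal (s n : ℕ) : (congrSubgroup s n).Normal where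
  conj_mem := fun v hv w i => by
    have h := modEq_apply_of_modEq w (hv ((w⁻¹ : Equiv.Perm ℤ) i))
    rw [show (w : Equiv.Perm ℤ) ((w⁻¹ : Equiv.Perm ℤ) i) = i from
      (w : Equiv.Perm ℤ).apply_symm_apply i] at h
    exact h

theorem congrSubgroup_le (s n : ℕ) : congrSubgroup s n ≤ congrSubgroup s 1 := by
  intro w hw i
  refine (hw i).of_dvd ?_
  push_cast
  rw [one_mul]
  exact dvd_mul_left _ _

theorem intCast_val_modEq (s : ℕ) [NeZero s] (m : ℤ) : (((m : ZMod s).val : ℕ) : ℤ) ≡ m [ZMOD s] := by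
  rw [ZMod.val_intCast]
  exact Int.mod_modEq _ _

/-- The action of the affine symmetric group on the classes modulo `s`. -/
def classAction (s : ℕ) [NeZero s] : AffineSym s →* Equiv.Perm (ZMod s) :=
  MonoidHom.toHomPerm
    { toFun := fun w x => (((w : Equiv.Perm ℤ) x.val : ℤ) : ZMod s)
      map_one' := by
        funext x
        change ((x.val : ℤ) : ZMod s) = x
        simp
      map_mul' := fun v w => by
        funext x
        have h := displacement_congr v
          (intCast_val_modEq s ((w : Equiv.Perm ℤ) (x.val : ℤ)))
        have h1 := (ZMod.intCast_eq_intCast_iff _ _ _).2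
          (intCast_val_modEq s ((w : Equiv.Perm ℤ) (x.val : ℤ)))
        change (((v : Equiv.Perm ℤ) ((w : Equiv.Perm ℤ) (x.val : ℤ)) : ℤ) : ZMod s) =
          (((v : Equiv.Perm ℤ) ((((w : Equiv.Perm ℤ) (x.val : ℤ) : ℤ) : ZMod s).val : ℤ) : ℤ) :
            ZMod s)
        have h2 := congrArg (Int.cast : ℤ → ZMod s) h
        rw [Int.cast_sub, Int.cast_sub, h1] at h2
        exact (sub_left_injective h2).symm }

theorem classAction_intCast (s : ℕ) [NeZero s] (w : AffineSym s) (m : ℤ) :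
    classAction s w (m : ZMod s) = (((w : Equiv.Perm ℤ) m : ℤ) : ZMod s) := by
  have h := displacement_congr w (intCast_val_modEq s m)
  have h1 := (ZMod.intCast_eq_intCast_iff _ _ _).2 (intCast_val_modEq s m)
  have h2 := congrArg (Int.cast : ℤ → ZMod s) h
  rw [Int.cast_sub, Int.cast_sub, h1] at h2
  exact sub_left_injective h2

theorem ker_classAction (s : ℕ) [NeZero s] : (classAction s).ker = congrSubgroup s 1 := by
  ext w
  rw [MonoidHom.mem_ker, mem_congrSubgroup, one_mul]
  constructor
  · intro h m
    have h1 := classAction_intCast s w m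
    rw [h] at h1
    exact (ZMod.intCast_eq_intCast_iff _ _ _).1 h1
  · intro h
    ext x
    obtain ⟨m, rfl⟩ := ZMod.intCast_surjective x
    rw [classAction_intCast, ← (ZMod.intCast_eq_intCast_iff _ _ _).2 (h m)]
    rfl

theorem sum_range_zmod (s : ℕ) [NeZero s] (f : ZMod s → ℤ) :
    ∑ m ∈ Finset.range s, f ((m : ℤ) : ZMod s) = ∑ x, f x := by
  refine Finset.sum_nbij' (fun m => ((m : ℤ) : ZMod s)) ZMod.val (by simp)
    (fun x _ => Finset.mem_range.2 (ZMod.val_lt x)) (fun m hm => ?_) (fun x _ => by simp)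
    fun _ _ => rfl
  simpa using ZMod.val_cast_of_lt (Finset.mem_range.1 hm)

/-- Lift `σ` by letting it act on the representatives `0, …, s - 1` and extending periodically;
permuting these representatives does not change their sum. -/
theorem classAction_surjective (s : ℕ) [NeZero s] : Function.Surjective (classAction s) := by
  intro σ
  let g : Equiv.Perm (ZMod s) → ℤ → ℤ := fun σ m =>
    m + ((σ (m : ZMod s)).val - ((m : ZMod s).val : ℤ))
  have hcast : ∀ σ m, ((g σ m : ℤ) : ZMod s) = σ (m : ZMod s) := by
    intro σ m
    simp [g]
  have hmul : ∀ σ τ m, g τ (g σ m) = g (τ * σ) m := by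
    intro σ τ m
    conv_lhs => simp only [g]
    change g σ m + ((τ ((g σ m : ℤ) : ZMod s)).val - ((((g σ m : ℤ) : ZMod s).val : ℕ) : ℤ)) = _
    rw [hcast]
    simp only [g, Equiv.Perm.mul_apply]
    ring
  have hone : ∀ m, g 1 m = m := by
    intro m
    simp [g]
  let w : AffineSym s :=
    ⟨{ toFun := g σ
       invFun := g σ⁻¹
       left_inv := fun m => by rw [hmul, inv_mul_cancel, hone]
       right_inv := fun m => by rw [hmul, mul_inv_cancel, hone] },
     fun m => by
       simp only [Equiv.coe_fn_mk, g, Int.cast_add, Int.cast_natCast, ZMod.natCast_self, add_zero]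
       ring, by
       simp only [Equiv.coe_fn_mk, g, Finset.sum_add_distrib, Finset.sum_sub_distrib,
         sum_range_cast]
       rw [sum_range_zmod s fun x => ((σ x).val : ℤ), sum_range_zmod s fun x => (x.val : ℤ),
         Equiv.sum_comp σ fun x => (x.val : ℤ)]
       ring⟩
  refine ⟨w, ?_⟩
  ext x
  obtain ⟨m, rfl⟩ := ZMod.intCast_surjective x
  rw [classAction_intCast]
  exact hcast σ m

theorem index_congrSubgroup_one {s : ℕ} (hs : 0 < s) : (congrSubgroup s 1).index = s ! := by
  have : NeZero s := ⟨hs.ne'⟩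
  rw [← ker_classAction, Subgroup.index_ker,
    MonoidHom.range_eq_top.2 (classAction_surjective s), Subgroup.card_top, Nat.card_perm,
    Nat.card_zmod]

theorem dvd_displacement {s : ℕ} {w : AffineSym s} (hw : w ∈ congrSubgroup s 1) (i : ℤ) :
    (s : ℤ) ∣ (w : Equiv.Perm ℤ) i - i := by
  have := Int.modEq_iff_dvd.1 (hw i)
  rwa [one_mul] at this

/-- The translation vector modulo `n` of a translation, without its last coordinate. -/
def translationVector (s n : ℕ) :
    congrSubgroup s 1 →* Multiplicative (Fin (s - 1) → ZMod n) where
  toFun w := Multiplicative.ofAdd fun i : Fin (s - 1) =>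
    ((((w : AffineSym s) : Equiv.Perm ℤ) (i : ℕ) - (i : ℕ)) / (s : ℤ) : ℤ)
  map_one' := by
    rw [← ofAdd_zero]
    congr 1
    ext i
    simp
  map_mul' := fun v w => by
    rw [← ofAdd_add]
    congr 1
    ext i
    have h := displacement_congr (v : AffineSym s) (a := ((i : ℕ) : ℤ))
      (b := ((w : AffineSym s) : Equiv.Perm ℤ) (i : ℕ)) (by simpa using w.2 (i : ℕ))
    rw [Pi.add_apply, ← Int.cast_add, h, ← Int.add_ediv_of_dvd_left]
    · congr 2
      simp
    · rw [← h]
      exact dvd_displacement v.2 _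

/-- The shifts over a period sum to zero, so the omitted last coordinate is divisible by `n` as soon
as the others are. -/
theorem ker_translationVector {s n : ℕ} (hs : 0 < s) :
    (translationVector s n).ker = (congrSubgroup s n).subgroupOf (congrSubgroup s 1) := by
  have hs' : (s : ℤ) ≠ 0 := by exact_mod_cast hs.ne'
  ext ⟨w, hw⟩
  rw [MonoidHom.mem_ker, Subgroup.mem_subgroupOf]
  choose d hd using dvd_displacement hw
  have hvec : ∀ i : Fin (s - 1), (translationVector s n ⟨w, hw⟩).toAdd i =
      ((d (i : ℕ) : ℤ) : ZMod n) := by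
    intro i
    change ((((w : Equiv.Perm ℤ) (i : ℕ) - (i : ℕ)) / (s : ℤ) : ℤ) : ZMod n) = _
    rw [hd, Int.mul_ediv_cancel_left _ hs']
  have hmem : w ∈ congrSubgroup s n ↔ ∀ i, (n : ℤ) ∣ d i := by
    rw [mem_congrSubgroup]
    refine forall_congr' fun i => ?_
    rw [Int.modEq_iff_dvd, hd, Nat.cast_mul, mul_comm (n : ℤ), mul_dvd_mul_iff_left hs']
  have hper : ∀ i, d (i + s) = d i := by
    intro i
    have h1 := hd (i + s)
    rw [w.2.1, add_sub_add_right_eq_sub, hd i] at h1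
    exact (mul_left_cancel₀ hs' h1).symm
  have hsum : ∑ i ∈ Finset.range s, d i = 0 := by
    have h1 := w.2.2
    have h2 : ∀ i, (w : Equiv.Perm ℤ) i = i + s * d i := fun i => by
      have := hd i
      linarith
    simp only [h2, Finset.sum_add_distrib, ← Finset.mul_sum, sum_range_cast] at h1
    exact (mul_eq_zero.1 (by linarith : (s : ℤ) * ∑ i ∈ Finset.range s, d i = 0)).resolve_left hs'
  change _ ↔ w ∈ congrSubgroup s n
  rw [hmem]
  constructor
  · intro h
    have h1 : ∀ i ∈ Finset.range (s - 1), (n : ℤ) ∣ d i := by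
      intro i hi
      have h2 := hvec ⟨i, Finset.mem_range.1 hi⟩
      rw [h] at h2
      exact (ZMod.intCast_zmod_eq_zero_iff_dvd _ _).1 h2.symm
    have h2 : (n : ℤ) ∣ d ((s - 1 : ℕ) : ℤ) := by
      have e : Finset.range s = Finset.range (s - 1 + 1) := by rw [Nat.sub_add_cancel hs]
      rw [e, Finset.sum_range_succ] at hsum
      rw [← dvd_add_right (Finset.dvd_sum h1), hsum]
      exact dvd_zero _
    intro i
    have h0 := Int.emod_nonneg i hs'
    have h3 := Int.emod_lt_of_pos i (by exact_mod_cast hs : (0 : ℤ) < s)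
    have h4 := periodic_add_mul d hper (i / s) (i % s)
    rw [Int.emod_add_mul_ediv, ← Int.toNat_of_nonneg h0] at h4
    rw [h4]
    by_cases h5 : (i % s).toNat = s - 1
    · rwa [h5]
    · exact h1 _ (Finset.mem_range.2 (by omega))
  · intro h
    apply Multiplicative.toAdd.injective
    ext i
    rw [hvec]
    exact (ZMod.intCast_zmod_eq_zero_iff_dvd _ _).2 (h _)

theorem translationVector_surjective {s n : ℕ} (hs : 0 < s) (hn : 0 < n) :
    Function.Surjective (translationVector s n) := by
  have : NeZero n := ⟨hn.ne'⟩
  obtain ⟨m, rfl⟩ : ∃ m, s = m + 1 := ⟨s - 1, by omega⟩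
  intro v
  let u : Fin m → ℤ := fun i => ((v.toAdd i).val : ℤ)
  let q : ℤ → ℤ := fun i => if h : (i % ((m + 1 : ℕ) : ℤ)).toNat < m then u ⟨_, h⟩ else -∑ j, u j
  have hq : ∀ i, q (i + ((m + 1 : ℕ) : ℤ)) = q i := by
    intro i
    simp only [q, Int.add_emod_right]
  have hqm : ∀ i : Fin m, q (i : ℕ) = u i := by
    intro i
    have e : (((i : ℕ) : ℤ) % ((m + 1 : ℕ) : ℤ)).toNat = i := by
      rw [Int.emod_eq_of_lt (by omega) (by omega)]
      simp
    simp only [q, e, i.2, dif_pos]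
  have hsum : ∑ i ∈ Finset.range (m + 1), q i = 0 := by
    rw [Finset.sum_range_succ, Finset.sum_range]
    simp only [hqm]
    have e : ((m : ℤ) % ((m + 1 : ℕ) : ℤ)).toNat = m := by
      rw [Int.emod_eq_of_lt (by omega) (by omega)]
      simp
    simp only [q, e, lt_irrefl, dif_neg, not_false_eq_true, add_neg_cancel]
  refine ⟨⟨translation q hq hsum, fun i => ?_⟩, ?_⟩
  · rw [translation_apply, one_mul, Int.modEq_iff_dvd, add_sub_cancel_left]
    exact dvd_mul_right _ _
  · apply Multiplicative.toAdd.injective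
    ext i
    change ((((translation q hq hsum : Equiv.Perm ℤ) ((i : ℕ) : ℤ) - ((i : ℕ) : ℤ)) /
      ((m + 1 : ℕ) : ℤ) : ℤ) : ZMod n) = v.toAdd i
    rw [translation_apply, add_sub_cancel_left, Int.mul_ediv_cancel_left _ (by positivity)]
    refine (congrArg _ (hqm i)).trans ?_
    simp [u]

theorem relIndex_congrSubgroup {s n : ℕ} (hs : 0 < s) (hn : 0 < n) :
    (congrSubgroup s n).relIndex (congrSubgroup s 1) = n ^ (s - 1) := by
  rw [Subgroup.relIndex, ← ker_translationVector hs, Subgroup.index_ker,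
    MonoidHom.range_eq_top.2 (translationVector_surjective hs hn), Subgroup.card_top,
    Nat.card_congr Multiplicative.toAdd, Nat.card_fun, Nat.card_zmod, Nat.card_fin]

theorem index_congrSubgroup {s n : ℕ} (hs : 0 < s) (hn : 0 < n) :
    (congrSubgroup s n).index = n ^ (s - 1) * s ! := by
  rw [← Subgroup.relIndex_mul_index (congrSubgroup_le s n), relIndex_congrSubgroup hs hn,
    index_congrSubgroup_one hs]

/-! ### The level `t` actions on cores -/

theorem isActionGraph_of {G X : Type*} [Group G] {R : G → X → X → Prop}
    (hR : ∀ g x, ∃! y, R g x y) (h1 : ∀ x, R 1 x x)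
    (hmul : ∀ g h x y z, R g x y → R h y z → R (h * g) x z) : IsActionGraph R := by
  choose f hf hf' using hR
  have hm : ∀ g h x, f h (f g x) = f (h * g) x := fun g h x =>
    hf' _ _ _ (hmul _ _ _ _ _ (hf g x) (hf h _))
  have ho : ∀ x, f 1 x = x := fun x => (hf' _ _ _ (h1 x)).symm
  refine ⟨{ toFun := fun g => ⟨f g, f g⁻¹, fun x => by rw [hm, inv_mul_cancel, ho],
              fun x => by rw [hm, mul_inv_cancel, ho]⟩
            map_one' := Equiv.ext ho
            map_mul' := fun g h => Equiv.ext fun x => (hm h g x).symm }, fun g x y => ?_⟩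
  constructor
  · intro h
    exact (hf' _ _ _ h).symm
  · rintro rfl
    exact hf g x

theorem apply_inv_apply {s : ℕ} (w : AffineSym s) (i : ℤ) :
    (w : Equiv.Perm ℤ) ((w⁻¹ : Equiv.Perm ℤ) i) = i :=
  (w : Equiv.Perm ℤ).apply_symm_apply i

theorem inv_apply_apply {s : ℕ} (w : AffineSym s) (i : ℤ) :
    (w⁻¹ : Equiv.Perm ℤ) ((w : Equiv.Perm ℤ) i) = i :=
  (w : Equiv.Perm ℤ).symm_apply_apply i

theorem actsOnCores_iff {s t : ℕ} (h : s.Coprime t) {w : AffineSym s} {la mu : Cores s}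
    {y z : ℤ → ℤ} (hy : HasSeq s t (betaSet la.1) y) (hz : HasSeq s t (betaSet mu.1) z) :
    ActsOnCores s t h w la mu ↔ ∀ i, z i = y ((w⁻¹ : Equiv.Perm ℤ) i) := by
  rw [ActsOnCores]
  constructor
  · intro e
    rw [e] at hz
    exact congrFun (hz.eq (hy.image h w))
  · intro e
    rw [funext e] at hz
    exact hz.set_eq h (hy.image h w)

theorem exists_actsOnCores {s t : ℕ} (hs : 2 ≤ s) (h : s.Coprime t) (w : AffineSym s)
    {la : Cores s} {y : ℤ → ℤ} (hy : HasSeq s t (betaSet la.1) y) :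
    ∃ mu : Cores s, ActsOnCores s t h w la mu ∧
      HasSeq s t (betaSet mu.1) fun i => y ((w⁻¹ : Equiv.Perm ℤ) i) := by
  have hL := comp_mem_levelSeq (by omega) (hy.mem_levelSeq hs h) w⁻¹
  rw [Subgroup.coe_inv] at hL
  obtain ⟨mu, hmu⟩ := exists_betaSet_hasSeq hs h hL
  let nu : Cores s := ⟨mu, hmu.isCore (by omega) h⟩
  have hnu : HasSeq s t (betaSet nu.1) fun i => y ((w⁻¹ : Equiv.Perm ℤ) i) := hmu
  refine ⟨nu, (actsOnCores_iff h hy hnu).2 ?_, hnu⟩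
  intro i
  rfl

theorem eq_of_hasSeq {s t : ℕ} (h : s.Coprime t) {la mu : YoungDiagram} {y : ℤ → ℤ}
    (hla : HasSeq s t (betaSet la) y) (hmu : HasSeq s t (betaSet mu) y) : la = mu :=
  betaSet_injective (hla.set_eq h hmu)

theorem isActionGraph_actsOnCores {s t : ℕ} (hs : 2 ≤ s) (h : s.Coprime t) :
    IsActionGraph (ActsOnCores s t h) := by
  refine isActionGraph_of (fun w la => ?_) (fun la => ?_) fun v w la mu nu hv hw => ?_
  · obtain ⟨y, hy⟩ := exists_hasSeq (s := s) (by omega) t la.2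
    obtain ⟨mu, hmu, -⟩ := exists_actsOnCores hs h w hy
    exact ⟨mu, hmu, fun nu hnu => Subtype.ext (betaSet_injective (hnu.trans hmu.symm))⟩
  · simp [ActsOnCores]
  · rw [ActsOnCores] at hv hw ⊢
    rw [hw, hv, map_mul, Equiv.Perm.coe_mul, Set.image_comp]

theorem actsOnBoundedCores_iff {s t N : ℕ} (hs : 2 ≤ s) (h : s.Coprime t) {w : AffineSym s}
    {la mu : BoundedCores s N} {y z : ℤ → ℤ} (hy : HasSeq s t (betaSet la.1) y)
    (hz : HasSeq s t (betaSet mu.1) z) :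
    ActsOnBoundedCores s t N h w la mu ↔ ∀ i, y ((w⁻¹ : Equiv.Perm ℤ) i) ≡ z i [ZMOD N] := by
  obtain ⟨ka, hka, hka'⟩ := exists_actsOnCores hs h w (la := ⟨la.1, la.2.1⟩) hy
  have hcongr := hka'.coreCongr_iff (N := N) (by omega) h hz
  rw [← hcongr]
  constructor
  · rintro ⟨ka', h1, h2⟩
    have e : ka' = ka := Subtype.ext (betaSet_injective (h1.trans hka.symm))
    rwa [e] at h2
  · intro h2
    exact ⟨ka, hka, h2⟩

theorem BoundedCores.exists_hasSeq {s t N : ℕ} (hs : 2 ≤ s) (h : s.Coprime t)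
    (la : BoundedCores s N) :
    ∃ y, HasSeq s t (betaSet la.1) y ∧ y ∈ levelSeq s t ∧ SmallSpread s t N y := by
  obtain ⟨y, hy⟩ := _root_.exists_hasSeq (s := s) (by omega) t la.2.1
  exact ⟨y, hy, hy.mem_levelSeq hs h, (hy.smallSpread_iff (by omega) h).1 la.2.2⟩

theorem exists_boundedCore {s t N : ℕ} (hs : 2 ≤ s) (h : s.Coprime t) {y : ℤ → ℤ}
    (hy : y ∈ levelSeq s t) (hy' : SmallSpread s t N y) :
    ∃ la : BoundedCores s N, HasSeq s t (betaSet la.1) y := by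
  obtain ⟨la, hla⟩ := exists_betaSet_hasSeq hs h hy
  exact ⟨⟨la, hla.isCore (by omega) h, (hla.smallSpread_iff (by omega) h).2 hy'⟩, hla⟩

/-- Reduced representatives exist and are unique, and congruence of sequences survives composition
with a permutation of the index, so reducing between two steps does no harm. -/
theorem isActionGraph_actsOnBoundedCores {s t N : ℕ} (hs : 2 ≤ s) (h : s.Coprime t)
    (hN : 0 < N) : IsActionGraph (ActsOnBoundedCores s t N h) := by
  refine isActionGraph_of (fun w la => ?_) (fun la => ?_) fun v w la mu nu hv hw => ?_
  · obtain ⟨y, hy, hyL, -⟩ := la.exists_hasSeq hs h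
    obtain ⟨z, hz, hz', hyz⟩ := exists_smallSpread hs h hN
      (comp_mem_levelSeq (by omega) hyL w⁻¹)
    obtain ⟨mu, hmu⟩ := exists_boundedCore hs h hz hz'
    refine ⟨mu, (actsOnBoundedCores_iff hs h hy hmu).2 hyz, fun nu hnu => ?_⟩
    obtain ⟨x, hx, hxL, hx'⟩ := nu.exists_hasSeq hs h
    replace hnu := (actsOnBoundedCores_iff hs h hy hx).1 hnu
    have e : x = z := hx'.eq hs hN hxL hz hz' fun i => (hnu i).symm.trans (hyz i)
    exact Subtype.ext (eq_of_hasSeq h hx (e ▸ hmu))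
  · obtain ⟨y, hy, -, -⟩ := la.exists_hasSeq hs h
    exact (actsOnBoundedCores_iff hs h hy hy).2 fun i => Int.ModEq.refl _
  · obtain ⟨y, hy, -, -⟩ := la.exists_hasSeq hs h
    obtain ⟨z, hz, -, -⟩ := mu.exists_hasSeq hs h
    obtain ⟨x, hx, -, -⟩ := nu.exists_hasSeq hs h
    rw [actsOnBoundedCores_iff hs h hy hz] at hv
    rw [actsOnBoundedCores_iff hs h hz hx] at hw
    rw [actsOnBoundedCores_iff hs h hy hx]
    intro i
    have e : ((w * v : AffineSym s) : Equiv.Perm ℤ)⁻¹ i =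
        (v⁻¹ : Equiv.Perm ℤ) ((w⁻¹ : Equiv.Perm ℤ) i) := by
      rw [Subgroup.coe_mul, mul_inv_rev, Equiv.Perm.mul_apply]
    rw [e]
    exact (hv _).trans (hw i)

theorem finite_boundedCores {s t N : ℕ} (hs : 2 ≤ s) (h : s.Coprime t) (hN : 0 < N) :
    Finite (BoundedCores s N) := by
  have : NeZero N := ⟨hN.ne'⟩
  choose Y hY hYL hYS using fun la : BoundedCores s N => la.exists_hasSeq hs h
  refine Finite.of_injective (β := Fin s → ZMod N) (fun la i => (Y la (i : ℕ) : ZMod N))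
    fun la mu hlm => ?_
  have hs' : (0 : ℤ) < s := by omega
  have e : Y la = Y mu := by
    refine (hYS la).eq hs hN (hYL la) (hYL mu) (hYS mu) fun i => ?_
    have h0 := Int.emod_nonneg i hs'.ne'
    have h1 := Int.emod_lt_of_pos i hs'
    have h2 := congrFun hlm ⟨(i % s).toNat, by omega⟩
    simp only [Int.toNat_of_nonneg h0] at h2
    have h3 := (ZMod.intCast_eq_intCast_iff _ _ _).1 h2
    rw [← Int.emod_add_mul_ediv i s, levelSeq_add_mul (hYL la).1, levelSeq_add_mul (hYL mu).1]
    exact h3.sub_right _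
  exact Subtype.ext (eq_of_hasSeq h (hY la) (e ▸ hY mu))

theorem exists_boundedCore_of_isCore {s t N : ℕ} (hs : 2 ≤ s) (h : s.Coprime t) (hN : t ≤ N)
    (mu : Cores s) (hmu : IsCore t mu.1) : ∃ nu : BoundedCores s N, nu.1 = mu.1 := by
  have hs0 : 0 < s := by omega
  have ht := pos_of_coprime hs h
  obtain ⟨y, hy⟩ := exists_hasSeq hs0 t mu.2
  exact ⟨⟨mu.1, mu.2, (hy.smallSpread_iff hs0 h).2 (smallSpread_of_antitone hs0 ht hN
    (hy.mem_levelSeq hs h) ((hy.isCore_iff_antitone ht h).1 hmu))⟩, rfl⟩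

/-! ### Stabilisers and orbits -/

/-- For modulus `n t` the reduction is itself a translation, so it can be absorbed into the group
element: the congruence becomes an equality. -/
theorem mem_boundedOrbit_iff {s t n : ℕ} (hs : 2 ≤ s) (h : s.Coprime t) (hn : 0 < n)
    {la mu : BoundedCores s (n * t)} {y z : ℤ → ℤ} (hy : HasSeq s t (betaSet la.1) y)
    (hz : HasSeq s t (betaSet mu.1) z) :
    mu ∈ boundedOrbit s t (n * t) h la ↔
      ∃ w : AffineSym s, ∀ i, z ((w : Equiv.Perm ℤ) i) = y i := by
  have ht := pos_of_coprime hs h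
  constructor
  · rintro ⟨w, hw⟩
    rw [actsOnBoundedCores_iff hs h hy hz] at hw
    obtain ⟨v, -, hv⟩ := exists_translation_of_modEq ht hn
      (comp_mem_levelSeq (by omega) (hy.mem_levelSeq hs h) w⁻¹) (hz.mem_levelSeq hs h) hw
    refine ⟨v⁻¹ * w, fun i => ?_⟩
    rw [hv, Subgroup.coe_mul, Equiv.Perm.mul_apply, Subgroup.coe_inv _ v, apply_inv_apply,
      Subgroup.coe_inv, inv_apply_apply]
  · rintro ⟨w, hw⟩
    refine ⟨w, (actsOnBoundedCores_iff hs h hy hz).2 fun i => ?_⟩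
    rw [← hw, apply_inv_apply]

/-- The stabiliser of a sequence in the affine symmetric group. -/
def seqStabilizer (s : ℕ) (y : ℤ → ℤ) : Subgroup (AffineSym s) where
  carrier := {w | ∀ i, y ((w : Equiv.Perm ℤ) i) = y i}
  one_mem' := fun _ => rfl
  mul_mem' := fun {_ _} hv hw i => (hv _).trans (hw i)
  inv_mem' := fun {w} hw i => by
    rw [← hw, Subgroup.coe_inv, apply_inv_apply]

theorem mem_seqStabilizer {s : ℕ} {y : ℤ → ℤ} {w : AffineSym s} :
    w ∈ seqStabilizer s y ↔ ∀ i, y ((w : Equiv.Perm ℤ) i) = y i := Iff.rfl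

theorem coreStabilizer_eq {s t : ℕ} (h : s.Coprime t) {la : Cores s} {y : ℤ → ℤ}
    (hy : HasSeq s t (betaSet la.1) y) :
    coreStabilizer s t h la = (seqStabilizer s y : Set (AffineSym s)) := by
  ext w
  rw [SetLike.mem_coe, ← inv_mem_iff, mem_seqStabilizer]
  refine (actsOnCores_iff h hy hy).trans (forall_congr' fun i => ?_)
  rw [Subgroup.coe_inv]
  exact eq_comm

/-- Moving `i` by `s n k` changes `y i` by `-t n k`, which is nonzero unless the shift is. -/
theorem congrSubgroup_inf_seqStabilizer {s t n : ℕ} (ht : 0 < t)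
    {y : ℤ → ℤ} (hy : y ∈ levelSeq s t) : congrSubgroup s n ⊓ seqStabilizer s y = ⊥ := by
  rw [eq_bot_iff]
  rintro w ⟨h1, h2⟩
  rw [Subgroup.mem_bot]
  apply Subtype.ext
  ext i
  obtain ⟨k, hk⟩ := Int.modEq_iff_dvd.1 (h1 i)
  have h3 := h2 i
  have e : (w : Equiv.Perm ℤ) i = i + s * (n * k) := by
    push_cast at hk
    linarith
  rw [e, levelSeq_add_mul hy.1] at h3
  have h4 : (t : ℤ) * (n * k) = 0 := by linarith
  have h5 : (n : ℤ) * k = 0 := (mul_eq_zero.1 h4).resolve_left (by exact_mod_cast ht.ne')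
  rw [e, h5]
  simp

/-- With `K` the congruence subgroup and `H` the stabiliser, `[K H : K] = [H : K ∩ H] = |H|`. -/
theorem index_congrSubgroup_sup_seqStabilizer {s t n : ℕ} (hs : 0 < s) (ht : 0 < t) (hn : 0 < n)
    {y : ℤ → ℤ} (hy : y ∈ levelSeq s t) :
    Nat.card (seqStabilizer s y) * (congrSubgroup s n ⊔ seqStabilizer s y).index =
      n ^ (s - 1) * s ! := by
  rw [← index_congrSubgroup hs hn,
    ← Subgroup.relIndex_mul_index (le_sup_left : congrSubgroup s n ≤ _ ⊔ seqStabilizer s y),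
    Subgroup.relIndex_sup_left, ← Subgroup.inf_relIndex_right,
    congrSubgroup_inf_seqStabilizer ht hy, Subgroup.relIndex_bot_left]

/-- This identifies the stabiliser for the bounded action: if `y ∘ w` is congruent to `y`, a
translation `v` gives `y ∘ w ∘ v = y`, so `w = (w v) v⁻¹` lies in the product. -/
theorem mem_congrSubgroup_sup_seqStabilizer {s t n : ℕ} (hs : 0 < s) (ht : 0 < t) (hn : 0 < n)
    {y : ℤ → ℤ} (hy : y ∈ levelSeq s t) (w : AffineSym s) :
    w ∈ congrSubgroup s n ⊔ seqStabilizer s y ↔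
      ∀ i, y ((w⁻¹ : Equiv.Perm ℤ) i) ≡ y i [ZMOD ((n * t : ℕ) : ℤ)] := by
  rw [← inv_mem_iff]
  change _ ↔ ∀ i, y (((w⁻¹ : AffineSym s) : Equiv.Perm ℤ) i) ≡ y i [ZMOD ((n * t : ℕ) : ℤ)]
  generalize w⁻¹ = w
  have hmove : ∀ v ∈ congrSubgroup s n, ∀ i,
      y ((v : Equiv.Perm ℤ) i) ≡ y i [ZMOD ((n * t : ℕ) : ℤ)] := by
    intro v hv i
    obtain ⟨k, hk⟩ := Int.modEq_iff_dvd.1 (hv i)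
    have e : (v : Equiv.Perm ℤ) i = i + s * (n * k) := by
      push_cast at hk
      linarith
    rw [e, levelSeq_add_mul hy.1, Int.modEq_iff_dvd]
    exact ⟨k, by push_cast; ring⟩
  constructor
  · intro hw
    rw [sup_comm, ← SetLike.mem_coe, Subgroup.mul_normal, Set.mem_mul] at hw
    obtain ⟨p, hp, v, hv, rfl⟩ := hw
    intro i
    rw [Subgroup.coe_mul, Equiv.Perm.mul_apply, hp]
    exact hmove v hv i
  · intro hw
    obtain ⟨v, hv, hv'⟩ := exists_translation_of_modEq ht hn (comp_mem_levelSeq hs hy w) hy hw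
    have hp : w * v ∈ seqStabilizer s y := fun i => (hv' i).symm
    rw [sup_comm, ← SetLike.mem_coe, Subgroup.mul_normal, Set.mem_mul]
    exact ⟨w * v, hp, v⁻¹, inv_mem (show v ∈ congrSubgroup s n from hv), mul_inv_cancel_right _ _⟩

theorem ncard_boundedOrbit {s t n : ℕ} (hs : 2 ≤ s) (h : s.Coprime t) (hn : 0 < n)
    (la : BoundedCores s (n * t)) {y : ℤ → ℤ} (hy : HasSeq s t (betaSet la.1) y) :
    (boundedOrbit s t (n * t) h la).ncard = (congrSubgroup s n ⊔ seqStabilizer s y).index := by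
  have ht := pos_of_coprime hs h
  obtain ⟨ρ, hρ⟩ := isActionGraph_actsOnBoundedCores hs h (Nat.mul_pos hn ht)
  let _ : MulAction (AffineSym s) (BoundedCores s (n * t)) := MulAction.compHom _ ρ
  have horb : boundedOrbit s t (n * t) h la = MulAction.orbit (AffineSym s) la := by
    ext mu
    exact exists_congr fun w => hρ w la mu
  have hstab : MulAction.stabilizer (AffineSym s) la = congrSubgroup s n ⊔ seqStabilizer s y := by
    ext w
    rw [mem_congrSubgroup_sup_seqStabilizer (by omega) ht hn (hy.mem_levelSeq hs h),
      ← actsOnBoundedCores_iff hs h hy hy, hρ]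
    rfl
  rw [horb, ← hstab, MulAction.index_stabilizer]

theorem exists_core_in_boundedOrbit {s t n : ℕ} (hs : 2 ≤ s) (h : s.Coprime t) (hn : 0 < n)
    (la : BoundedCores s (n * t)) :
    ∃ mu ∈ boundedOrbit s t (n * t) h la, IsCore t mu.1 := by
  have ht := pos_of_coprime hs h
  obtain ⟨y, hy, hyL, -⟩ := la.exists_hasSeq hs h
  obtain ⟨w, hw⟩ := exists_antitone hs h hyL
  have hzL := comp_mem_levelSeq (by omega) hyL w
  obtain ⟨mu, hmu⟩ := exists_boundedCore (N := n * t) hs h hzL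
    (smallSpread_of_antitone (by omega) ht (Nat.le_mul_of_pos_left t hn) hzL hw)
  refine ⟨mu, (mem_boundedOrbit_iff hs h hn hy hmu).2 ⟨w⁻¹, fun i => ?_⟩,
    (hmu.isCore_iff_antitone ht h).2 hw⟩
  simp only [Subgroup.coe_inv, apply_inv_apply]

/-- Runner charges are constant on the orbit and survive removal of `t`-rim hooks, and they
determine a `t`-core. -/
theorem isCoreOf_iff_of_mem_boundedOrbit {s t n : ℕ} (hs : 2 ≤ s) (h : s.Coprime t) (hn : 0 < n)
    {la mu ka : BoundedCores s (n * t)} (hmu : mu ∈ boundedOrbit s t (n * t) h la)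
    (hmu' : IsCore t mu.1) (hka : ka ∈ boundedOrbit s t (n * t) h la) (nu : YoungDiagram) :
    IsCoreOf t nu ka.1 ↔ nu = mu.1 := by
  have ht := pos_of_coprime hs h
  obtain ⟨y, hy, -, -⟩ := la.exists_hasSeq hs h
  obtain ⟨z, hz, -, -⟩ := mu.exists_hasSeq hs h
  obtain ⟨x, hx, -, -⟩ := ka.exists_hasSeq hs h
  obtain ⟨w, hw⟩ := (mem_boundedOrbit_iff hs h hn hy hz).1 hmu
  obtain ⟨v, hv⟩ := (mem_boundedOrbit_iff hs h hn hy hx).1 hka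
  have key : ∀ nu, IsCoreOf t nu ka.1 → nu = mu.1 := by
    intro nu hnu
    refine hnu.1.eq_of_runners ht h hmu' fun r c hc => ?_
    rw [hnu.hasCharge_runner_iff ht] at hc
    refine hx.hasCharge_runner_comp hs hz (w := w * v⁻¹) (fun i => ?_) hc
    rw [Subgroup.coe_mul, Equiv.Perm.mul_apply, hw, ← hv, Subgroup.coe_inv, apply_inv_apply]
  refine ⟨key nu, ?_⟩
  rintro rfl
  -- Some `t`-core of `ka` exists, and `key` identifies it with `mu`.
  obtain ⟨nu, hnu⟩ := exists_isCoreOf ht ka.1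
  rwa [← key nu hnu]

theorem mainTheorem5 (s t n : ℕ) (hs : 2 ≤ s) (hst : s.Coprime t) (hn : 1 ≤ n) :
    -- the level `t` actions on all `s`-cores and on the bounded ones are well-defined actions
    IsActionGraph (ActsOnCores s t hst) ∧
    IsActionGraph (ActsOnBoundedCores s t (n * t) hst) ∧
    Finite (BoundedCores s (n * t)) ∧
    -- every `(s, t)`-core is bounded
    (∀ mu : Cores s, IsCore t mu.1 → ∃ nu : BoundedCores s (n * t), nu.1 = mu.1) ∧
    ∀ la : BoundedCores s (n * t),
      -- the size of the orbit
      (coreStabilizer s t hst ⟨la.1, la.2.1⟩).Finite ∧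
      ((boundedOrbit s t (n * t) hst la).ncard : ℚ) =
        (n : ℚ) ^ (s - 1) * s ! / (coreStabilizer s t hst ⟨la.1, la.2.1⟩).ncard ∧
      -- the unique `(s, t)`-core in the orbit is the `t`-core of each member
      ∃ mu ∈ boundedOrbit s t (n * t) hst la,
        IsCore t mu.1 ∧
        (∀ nu ∈ boundedOrbit s t (n * t) hst la, IsCore t nu.1 → nu = mu) ∧
        ∀ ka ∈ boundedOrbit s t (n * t) hst la, ∀ nu : YoungDiagram,
          IsCoreOf t nu ka.1 ↔ nu = mu.1 := by
  have hs0 : 0 < s := by omega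
  have ht := pos_of_coprime hs hst
  have hnt : 0 < n * t := Nat.mul_pos hn ht
  refine ⟨isActionGraph_actsOnCores hs hst, isActionGraph_actsOnBoundedCores hs hst hnt,
    finite_boundedCores hs hst hnt,
    exists_boundedCore_of_isCore hs hst (Nat.le_mul_of_pos_left t hn), fun la => ?_⟩
  obtain ⟨y, hy, hyL, -⟩ := la.exists_hasSeq hs hst
  have hindex := index_congrSubgroup_sup_seqStabilizer hs0 ht hn hyL
  -- `Nat.card` is zero on infinite types, so the positive product in `hindex` yields finiteness of
  -- the stabiliser.
  have hcard : Nat.card (seqStabilizer s y) ≠ 0 := by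
    intro h0
    rw [h0, zero_mul] at hindex
    have : 0 < n ^ (s - 1) * s ! := by positivity
    omega
  rw [coreStabilizer_eq hst (la := ⟨la.1, la.2.1⟩) hy]
  refine ⟨?_, ?_, ?_⟩
  · have : Finite (seqStabilizer s y) := Nat.finite_of_card_ne_zero hcard
    exact Set.toFinite (seqStabilizer s y : Set (AffineSym s))
  · have hcard' : ((seqStabilizer s y : Set (AffineSym s)).ncard : ℚ) ≠ 0 := by
      rw [← Nat.card_coe_set_eq]
      exact_mod_cast hcard
    rw [eq_div_iff hcard', ncard_boundedOrbit hs hst hn la hy, mul_comm, ← Nat.card_coe_set_eq]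
    exact_mod_cast hindex
  · obtain ⟨mu, hmu, hmu'⟩ := exists_core_in_boundedOrbit hs hst hn la
    have key := fun ka hka =>
      isCoreOf_iff_of_mem_boundedOrbit (ka := ka) hs hst hn hmu hmu' hka
    -- A `t`-core is its own `t`-core through the empty chain of removals, so `key` also gives
    -- uniqueness.
    exact ⟨mu, hmu, hmu', fun nu hnu hnu' => Subtype.ext
      ((key nu hnu nu.1).1 ⟨hnu', Relation.ReflTransGen.refl⟩), key⟩
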